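/- Let $N\ge 1$ be an integer, $\sigma,\delta\in\{1,-1\}$, let $A,T\in\mathbb C^{2N\times 2N}$ and $C^{\pm}\in\mathbb C^{2N}$ be constant, and let ${}^*$ denote entrywise complex conjugation. Assume $$C^-=T\,C^{+*},\qquad AT+\sigma TA^*=0,\qquad TT^*=\delta\sigma I_{2N}.$$ For real $x$ and real $t=(t_2,t_4,t_6,\dots)$ such that $\sum_{j\ge 1}A^{2j}t_{2j}$ converges (unconditionally; e.g. only finitely many $t_{2j}$ are nonzero), put $$\varphi(x,t)=\exp\Bigl(\tfrac12Ax+\tfrac i2\sum_{j\ge1}A^{2j}t_{2j}\Bigr)C^+,\qquad \psi(x,t)=\exp\Bigl(-\tfrac12Ax-\tfrac i2\sum_{j\ge1}A^{2j}t_{2j}\Bigr)C^-.$$ For $a+b=2N$ write $|\widehat{a-1};\widehat{b-1}|=\det(\varphi,\partial_x\varphi,\dots,\partial_x^{a-1}\varphi,\psi,\partial_x\psi,\dots,\partial_x^{b-1}\psi)$, let $$f=|\widehat{N-1};\widehat{N-1}|,\qquad g=2|\widehat N;\widehat{N-2}|,\qquad h=2|\widehat{N-2};\widehat N|,$$ and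 let $q=h/f$, $r=-g/f$ where $f\neq0$. Let $K_n=(K_{1,n},K_{2,n})^T=L^n(-q,r)^T$ be the AKNS flows, i.e. the differential polynomials in two functions $q,r$ of $x$ generated by $$L=\begin{pmatrix}-\partial_x+2q\,\partial_x^{-1}r&2q\,\partial_x^{-1}q\\-2r\,\partial_x^{-1}r&\partial_x-2r\,\partial_x^{-1}q\end{pmatrix},$$ where $\partial_x^{-1}$ (applied to the combinations $r a+q b$ that occur when $L$ acts on $(a,b)^T=K_n$, which are total $x$-derivatives) is the inverse of the total derivative on differential polynomials with integration constant zero. Then: 1. $\psi(x,t)=T\,\varphi^*(\sigma x,t)$ for all such $(x,t)$. 2. If $f(x,t)\ne0$, then $f(\sigma x,t)\neq0$ and $r(x,t)=\delta\,q^*(\sigma x,t)$. 3. The function $$q=2\,\frac{|\widehat{N-2};\widehat N|}{|\widehat{N-1};\widehat{N-1}|}$$ solves the NLS hierarchy (classical if $\sigma=1$, nonlocal if $\sigma=-1$) at every such point $(x,t)$ with $f(x,t)\ne 0$: for every $l=1,2,\dots$, $q$ is smooth in $(x,t_{2l})$ near that point, and there $$i\,q_{t_{2l}}=-K_{1,2l}\big|_{r(x,t)=\delta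 q^*(\sigma x,t)}.$$ -/

import Mathlib

open scoped Matrix ContDiff

namespace AKNS

noncomputable section

/-! Differential polynomials in two functions `q`, `r` of `x`, and the AKNS hierarchy. -/

/-- Differential polynomials with complex coefficients: the variable `(0, k)` stands for
`∂ₓᵏ q` and the variable `(1, k)` for `∂ₓᵏ r`. -/
abbrev DiffPoly : Type := MvPolynomial (Fin 2 × ℕ) ℂ

/-- The differential polynomial `q`. -/
def qVar : DiffPoly := MvPolynomial.X (0, 0)

/-- The differential polynomial `r`. -/
def rVar : DiffPoly := MvPolynomial.X (1, 0)

/-- The total derivative `∂ₓ` on differential polynomials. -/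
def totalD : Derivation ℂ DiffPoly DiffPoly :=
  MvPolynomial.mkDerivation ℂ fun v => MvPolynomial.X (v.1, v.2 + 1)

open Classical in
/-- The operator `∂ₓ⁻¹` with integration constant zero: the differential polynomial without
constant term whose total derivative is `P`. It is unique (`eq_of_totalD_eq`), and it exists
wherever the AKNS recursion uses it (`flow_antiD_spec`). -/
def antiD (P : DiffPoly) : DiffPoly :=
  if h : ∃ W : DiffPoly, totalD W = P ∧ MvPolynomial.constantCoeff W = 0 then h.choose else 0

/-- The AKNS recursion operator
`L = !![-∂ₓ + 2 q ∂ₓ⁻¹ r, 2 q ∂ₓ⁻¹ q; -2 r ∂ₓ⁻¹ r, ∂ₓ - 2 r ∂ₓ⁻¹ q]`. -/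
def recursionOp (u : DiffPoly × DiffPoly) : DiffPoly × DiffPoly :=
  (-totalD u.1 + 2 * qVar * antiD (rVar * u.1 + qVar * u.2),
    totalD u.2 - 2 * rVar * antiD (rVar * u.1 + qVar * u.2))

/-- The right-hand side `K n = (K₁ₙ, K₂ₙ) = Lⁿ (-q, r)` of the `n`-th AKNS equation. -/
def K (n : ℕ) : DiffPoly × DiffPoly := recursionOp^[n] (-qVar, rVar)

/-- The value at `x` of the differential polynomial `P` on the functions `q`, `r`. -/
def evalJet (q r : ℝ → ℂ) (x : ℝ) (P : DiffPoly) : ℂ :=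
  MvPolynomial.eval (fun v : Fin 2 × ℕ => iteratedDeriv v.2 (![q, r] v.1) x) P

theorem totalD_X (i : Fin 2) (k : ℕ) :
    totalD (MvPolynomial.X (i, k)) = MvPolynomial.X (i, k + 1) := by
  simp [totalD]

theorem pderiv_succ_totalD (i : Fin 2) (k : ℕ) (P : DiffPoly) :
    MvPolynomial.pderiv (i, k + 1) (totalD P) =
      MvPolynomial.pderiv (i, k) P + totalD (MvPolynomial.pderiv (i, k + 1) P) := by
  have h : ⁅MvPolynomial.pderiv (R := ℂ) (i, k + 1), totalD⁆ = MvPolynomial.pderiv (i, k) := by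
    apply MvPolynomial.derivation_ext
    rintro ⟨j, m⟩
    rw [Derivation.commutator_apply, totalD_X, MvPolynomial.pderiv_X, MvPolynomial.pderiv_X,
      MvPolynomial.pderiv_X]
    by_cases h1 : j = i <;> by_cases h2 : m = k <;> by_cases h3 : m = k + 1 <;>
      simp [h1, h2, h3]
  have h' := congrArg (fun d : Derivation ℂ DiffPoly DiffPoly => d P) h
  simp only [Derivation.commutator_apply] at h'
  rw [← h']
  ring

/-- `∂ₓ⁻¹` is unambiguous. -/
theorem eq_of_totalD_eq {P Q : DiffPoly} (h : totalD P = totalD Q)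
    (hc : MvPolynomial.constantCoeff P = MvPolynomial.constantCoeff Q) : P = Q := by
  classical
  obtain ⟨R, rfl⟩ : ∃ R, P = Q + R := ⟨P - Q, by ring⟩
  have hD : totalD R = 0 := by simpa using h
  have hc0 : MvPolynomial.constantCoeff R = 0 := by simpa using hc
  obtain ⟨B, hB⟩ : ∃ B : ℕ, ∀ v ∈ R.vars, v.2 < B :=
    ⟨R.vars.sup (fun v => v.2) + 1, fun v hv =>
      Nat.lt_succ_of_le (Finset.le_sup (f := fun v : Fin 2 × ℕ => v.2) hv)⟩
  have hp : ∀ (i : Fin 2) (m k : ℕ), B ≤ k + m → MvPolynomial.pderiv (i, k) R = 0 := by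
    intro i m
    induction m with
    | zero =>
      intro k hk
      exact MvPolynomial.pderiv_eq_zero_of_notMem_vars fun hv => absurd (hB _ hv) (by simpa using hk)
    | succ m ih =>
      intro k hk
      have := pderiv_succ_totalD i k R
      rw [hD, ih (k + 1) (by omega)] at this
      simpa using this.symm
  have hR : R = 0 := by
    ext m
    by_cases hm : m = 0
    · subst hm
      simpa [MvPolynomial.constantCoeff_eq] using hc0
    · obtain ⟨⟨i, k⟩, hv⟩ := Finsupp.ne_iff.mp hm
      have h0 := MvPolynomial.coeff_pderiv (i := (i, k)) R (m - Finsupp.single (i, k) 1)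
      rw [hp i B k (by omega)] at h0
      have hle : Finsupp.single (i, k) 1 ≤ m := by
        rw [Finsupp.single_le_iff]
        exact Nat.one_le_iff_ne_zero.mpr (by simpa using hv)
      rw [tsub_add_cancel_of_le hle] at h0
      rw [MvPolynomial.coeff_zero] at h0
      exact (mul_eq_zero.mp h0.symm).resolve_right (Nat.cast_add_one_ne_zero _)
  simp [hR]

theorem antiD_spec {P : DiffPoly}
    (h : ∃ W : DiffPoly, totalD W = P ∧ MvPolynomial.constantCoeff W = 0) :
    totalD (antiD P) = P ∧ MvPolynomial.constantCoeff (antiD P) = 0 := by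
  unfold antiD
  rw [dif_pos h]
  exact h.choose_spec

theorem constantCoeff_antiD (P : DiffPoly) : MvPolynomial.constantCoeff (antiD P) = 0 := by
  by_cases h : ∃ W : DiffPoly, totalD W = P ∧ MvPolynomial.constantCoeff W = 0
  · exact (antiD_spec h).2
  · simp [antiD, h]

theorem constantCoeff_totalD (P : DiffPoly) : MvPolynomial.constantCoeff (totalD P) = 0 := by
  induction P using MvPolynomial.induction_on with
  | C a => simp [totalD]
  | add p q hp hq => simp [hp, hq]
  | mul_X p v hp =>
    obtain ⟨i, k⟩ := v
    rw [Derivation.leibniz, totalD_X]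
    simp

theorem constantCoeff_K (n : ℕ) :
    MvPolynomial.constantCoeff (K n).1 = 0 ∧ MvPolynomial.constantCoeff (K n).2 = 0 := by
  cases n with
  | zero => simp [K, qVar, rVar]
  | succ n =>
    unfold K
    rw [Function.iterate_succ_apply']
    simp [recursionOp, constantCoeff_totalD, constantCoeff_antiD]

/-- In every step of the AKNS recursion `∂ₓ⁻¹` is applied to a total derivative. -/
theorem flow_antiD_spec (n : ℕ) :
    totalD (antiD (rVar * (K n).1 + qVar * (K n).2)) = rVar * (K n).1 + qVar * (K n).2 ∧
      MvPolynomial.constantCoeff (antiD (rVar * (K n).1 + qVar * (K n).2)) = 0 := by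
  induction n using Nat.strong_induction_on with
  | _ n ih =>
  cases n with
  | zero => exact antiD_spec ⟨0, by simp [K]; ring, by simp⟩
  | succ n =>
    apply antiD_spec
    set w : ℕ → DiffPoly := fun j => antiD (rVar * (K j).1 + qVar * (K j).2) with hw
    have h1 : ∀ j, (K (j + 1)).1 = -totalD (K j).1 + 2 * qVar * w j := fun j => by
      simp only [K, Function.iterate_succ_apply']; rfl
    have h2 : ∀ j, (K (j + 1)).2 = totalD (K j).2 - 2 * rVar * w j := fun j => by
      simp only [K, Function.iterate_succ_apply']; rfl
    refine ⟨∑ p ∈ Finset.HasAntidiagonal.antidiagonal n, (w p.1 * w p.2 - (K p.1).1 * (K p.2).2), ?_, ?_⟩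
    · have hD : ∀ p ∈ Finset.HasAntidiagonal.antidiagonal n,
          totalD (w p.1 * w p.2 - (K p.1).1 * (K p.2).2) =
            ((K (p.1 + 1)).1 * (K p.2).2 - (K p.1).1 * (K (p.2 + 1)).2)
            + (w p.2 * (rVar * (K p.1).1 + qVar * (K p.1).2) - 2 * (w p.2 * (rVar * (K p.1).1))
            + (w p.1 * (rVar * (K p.2).1 - qVar * (K p.2).2))) := by
        intro p hp
        have hp' := Finset.HasAntidiagonal.mem_antidiagonal.mp hp
        rw [map_sub, Derivation.leibniz, Derivation.leibniz, (ih p.1 (by omega)).1,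
          (ih p.2 (by omega)).1, h1, h2]
        simp only [smul_eq_mul]
        ring
      have hs : ∑ p ∈ Finset.HasAntidiagonal.antidiagonal n, w p.1 * (rVar * (K p.2).1 - qVar * (K p.2).2) =
          ∑ p ∈ Finset.HasAntidiagonal.antidiagonal n, w p.2 * (rVar * (K p.1).1 - qVar * (K p.1).2) :=
        (Finset.Nat.sum_antidiagonal_swap (n := n)
          (f := fun p => w p.1 * (rVar * (K p.2).1 - qVar * (K p.2).2))).symm
      have ht1 := Finset.Nat.sum_antidiagonal_succ (n := n)
        (f := fun p => (K p.1).1 * (K p.2).2)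
      have ht2 := Finset.Nat.sum_antidiagonal_succ' (n := n)
        (f := fun p => (K p.1).1 * (K p.2).2)
      have hz : ∀ p ∈ Finset.HasAntidiagonal.antidiagonal n,
          w p.2 * (rVar * (K p.1).1 + qVar * (K p.1).2) - 2 * (w p.2 * (rVar * (K p.1).1))
            + w p.2 * (rVar * (K p.1).1 - qVar * (K p.1).2) = 0 := fun p _ => by ring
      rw [map_sum, Finset.sum_congr rfl hD, Finset.sum_add_distrib, Finset.sum_add_distrib, hs,
        ← Finset.sum_add_distrib, Finset.sum_eq_zero hz, add_zero, Finset.sum_sub_distrib]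
      have h0 : (K 0).1 = -qVar ∧ (K 0).2 = rVar := ⟨rfl, rfl⟩
      simp only [h0.1, h0.2] at ht1 ht2
      linear_combination ht2 - ht1
    · rw [map_sum]
      refine Finset.sum_eq_zero fun p _ => ?_
      simp [hw, constantCoeff_antiD, (constantCoeff_K _).1]

/-! Double Wronskians. -/

/-- The double Wronskian of order `n` with `a` columns `φ, φ', …, φ^(a-1)` followed by the
`n - a` columns `ψ, ψ', …, ψ^(n-a-1)`; the derivatives are taken in `x`. -/
def doubleWronskian {n : ℕ} (φ ψ : ℝ → Fin n → ℂ) (a : ℕ) (x : ℝ) : ℂ :=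
  Matrix.det (Matrix.of fun i j : Fin n =>
    if (j : ℕ) < a then iteratedDeriv j (fun y => φ y i) x
    else iteratedDeriv (j - a) (fun y => ψ y i) x)

/-- Points `(x, t)`, where `t l` stands for the time `t_{2l}`, `l = 1, 2, …`. -/
abbrev Times : Type := ℕ+ → ℝ

/-- The series `∑ A^(2j) t_{2j}` converges. -/
def Admissible {n : ℕ} (A : Matrix (Fin n) (Fin n) ℂ) (t : Times) : Prop :=
  Summable fun j : ℕ+ => (t j : ℂ) • A ^ (2 * (j : ℕ))

/-- `(1/2) A x + (i/2) ∑ A^(2j) t_{2j}`. -/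
def phase {n : ℕ} (A : Matrix (Fin n) (Fin n) ℂ) (x : ℝ) (t : Times) :
    Matrix (Fin n) (Fin n) ℂ :=
  ((x : ℂ) / 2) • A + (Complex.I / 2) • ∑' j : ℕ+, (t j : ℂ) • A ^ (2 * (j : ℕ))

/-- `φ = exp ((1/2) A x + (i/2) ∑ A^(2j) t_{2j}) C⁺`. -/
def phi {n : ℕ} (A : Matrix (Fin n) (Fin n) ℂ) (Cp : Fin n → ℂ) (x : ℝ) (t : Times) :
    Fin n → ℂ :=
  NormedSpace.exp (phase A x t) *ᵥ Cp

/-- `ψ = exp (-(1/2) A x - (i/2) ∑ A^(2j) t_{2j}) C⁻`. -/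
def psi {n : ℕ} (A : Matrix (Fin n) (Fin n) ℂ) (Cm : Fin n → ℂ) (x : ℝ) (t : Times) :
    Fin n → ℂ :=
  NormedSpace.exp (-phase A x t) *ᵥ Cm

/-! The functions `f`, `g`, `h` for `M = N`, and `q = h / f`, `r = -g / f`. -/

section
variable {N : ℕ} (A : Matrix (Fin (2 * N)) (Fin (2 * N)) ℂ) (Cp Cm : Fin (2 * N) → ℂ)

/-- `f = |0, …, N-1; 0, …, N-1|`. -/
def tauF (x : ℝ) (t : Times) : ℂ :=
  doubleWronskian (fun y => phi A Cp y t) (fun y => psi A Cm y t) N x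

/-- `g = 2 |0, …, N; 0, …, N-2|`. -/
def tauG (x : ℝ) (t : Times) : ℂ :=
  2 * doubleWronskian (fun y => phi A Cp y t) (fun y => psi A Cm y t) (N + 1) x

/-- `h = 2 |0, …, N-2; 0, …, N|`. -/
def tauH (x : ℝ) (t : Times) : ℂ :=
  2 * doubleWronskian (fun y => phi A Cp y t) (fun y => psi A Cm y t) (N - 1) x

/-- `q = h / f`. -/
def qSol (x : ℝ) (t : Times) : ℂ := tauH A Cp Cm x t / tauF A Cp Cm x t

/-- `r = -g / f`. -/
def rSol (x : ℝ) (t : Times) : ℂ := -tauG A Cp Cm x t / tauF A Cp Cm x t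

end

/-- The reduced function `(x, t) ↦ δ q*(σ x, t)`. -/
def reduction (σ δ : ℝ) (q : ℝ → Times → ℂ) (x : ℝ) (t : Times) : ℂ :=
  δ * starRingEnd ℂ (q (σ * x) t)

/-- `q` solves the NLS hierarchy `i q_{t_{2l}} = -K₁,₂ₗ`, `l = 1, 2, …`, with
`r(x, t) = δ q*(σ x, t)`, on `Ω`: the set `Ω` is invariant under `x ↦ σ x`, and at each of its
points `q` is, for every `l`, smooth in `(x, t_{2l})` and satisfies the `l`-th equation. -/
def SolvesNLSHierarchyOn (σ δ : ℝ) (q : ℝ → Times → ℂ) (Ω : Set (ℝ × Times)) : Prop :=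
  ∀ x t, (x, t) ∈ Ω → (σ * x, t) ∈ Ω ∧ ∀ l : ℕ+,
    ContDiffAt ℝ ∞ (fun p : ℝ × ℝ => q p.1 (Function.update t l p.2)) (x, t l) ∧
    Complex.I * deriv (fun s : ℝ => q x (Function.update t l s)) (t l) =
      -evalJet (fun y => q y t) (fun y => reduction σ δ q y t) x (K (2 * (l : ℕ))).1

end

end AKNS

namespace AKNS

noncomputable section

/-! Differential polynomials evaluated on smooth functions. -/

/-! The proof is a dressing argument. Let `Φ` be the matrix with columns `φ`, `ψ`. It satisfies `Φ_x
= (1/2) A Φ σ₃` and `Φ_{t_{2l}} = (i/2) A^{2l} Φ σ₃`. Where `f ≠ 0`, the columns of `Φ, AΦ, …,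
A^{N-1}Φ` are independent, so there is exactly one monic polynomial `λᴺ m`, with `m = 1 + m₁ λ⁻¹ + …
+ m_N λ⁻ᴺ` and 2×2 coefficients placed on the right, that annihilates `Φ` when `λ` is replaced by
`A`. Cramer's rule writes the entries of `m₁` as quotients of determinants, and the off-diagonal
ones give `q = -(m₁)₀₁` and `r = (m₁)₁₀` (`qSol_eq`, `rSol_eq`).

Put `R = m⁻¹ σ₃ m`. If `Φ' = c Aⁿ Φ σ₃`, differentiating the annihilation relation and using
uniqueness gives `m' = -c m (λⁿ R)₋`, where the minus selects the negative powers of `λ`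
(`dressing_flow`). For `∂ₓ` this yields the Lax equation `R' = (1/2)[R, λ σ₃ + R₁]`
(`hasCoeffDerivAt_resolvent`). Its off-diagonal part is the AKNS recursion. The diagonal is fixed
without integration by `R² = 1`, whose coefficients form the same quadratic recursion as the
potentials `∂ₓ⁻¹(r K₁ₙ + q K₂ₙ)` with zero integration constant (`potential_succ`). Hence
`(R_{n+1})₀₁ = 2 K₁ₙ` (`resolvent_eq_flow`). The `λ⁻¹` coefficient of the time flow is `m₁' = -(i/2)
R_{2l+1}`, so `q_{t_{2l}} = i K₁,₂ₗ` with `r` still independent (`qSol_flow`).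

For the reduction, the hypotheses on `T` give `T Φ*(σx) = Φ(x) S` with a constant invertible `S`.
Conjugation therefore turns polynomials annihilating `Φ(σx)` into polynomials annihilating `Φ(x)`.
Uniqueness then transfers `f ≠ 0` from `x` to `σx` and relates `m₁` at the two points, which is
`r(x) = δ q*(σx)` (`coeff_one_dressing_conj`). -/

theorem hasDerivAt_iteratedDeriv {u : ℝ → ℂ} {x : ℝ} (hu : ContDiffAt ℝ ∞ u x) (k : ℕ) :
    HasDerivAt (iteratedDeriv k u) (iteratedDeriv (k + 1) u x) x := by
  have h : ContDiffAt ℝ 1 (iteratedDeriv k u) x := by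
    rw [iteratedDeriv_eq_equiv_comp]
    exact ContDiffAt.comp x (LinearIsometryEquiv.contDiff _).contDiffAt
      (hu.iteratedFDeriv_right (m := 1) (i := k) (by exact_mod_cast le_top))
  rw [iteratedDeriv_succ]
  exact (h.differentiableAt one_ne_zero).hasDerivAt

theorem hasDerivAt_evalJet {q r : ℝ → ℂ} {x : ℝ} (hq : ContDiffAt ℝ ∞ q x)
    (hr : ContDiffAt ℝ ∞ r x) (P : DiffPoly) :
    HasDerivAt (fun y => evalJet q r y P) (evalJet q r x (totalD P)) x := by
  have hs : ∀ i : Fin 2, ContDiffAt ℝ ∞ (![q, r] i) x := by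
    intro i; fin_cases i <;> assumption
  induction P using MvPolynomial.induction_on with
  | C a => simpa [evalJet, totalD] using hasDerivAt_const x a
  | add p q hp hq => simpa [evalJet] using hp.fun_add hq
  | mul_X p v hp =>
    obtain ⟨i, k⟩ := v
    have h := hp.fun_mul (hasDerivAt_iteratedDeriv (hs i) k)
    refine HasDerivAt.congr_deriv (f := fun y => evalJet q r y (p * MvPolynomial.X (i, k)))
      (f' := _) (by simpa [evalJet] using h) ?_
    simp only [evalJet, Derivation.leibniz, totalD_X, smul_eq_mul, map_add, map_mul,
      MvPolynomial.eval_X]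
    ring

theorem evalJet_congr {q q' r r' : ℝ → ℂ} {x : ℝ} (hq : q =ᶠ[nhds x] q')
    (hr : r =ᶠ[nhds x] r') (P : DiffPoly) : evalJet q r x P = evalJet q' r' x P := by
  unfold evalJet
  congr 2
  funext ⟨i, k⟩
  fin_cases i
  · exact (hq.iteratedDeriv k).eq_of_nhds
  · exact (hr.iteratedDeriv k).eq_of_nhds

/-- The potential `∂ₓ⁻¹ (r K₁ₙ + q K₂ₙ)` of the AKNS recursion. -/
def potential (n : ℕ) : DiffPoly := antiD (rVar * (K n).1 + qVar * (K n).2)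

theorem K_succ_fst (n : ℕ) :
    (K (n + 1)).1 = -totalD (K n).1 + 2 * qVar * potential n := by
  simp only [K, Function.iterate_succ_apply']; rfl

theorem K_succ_snd (n : ℕ) :
    (K (n + 1)).2 = totalD (K n).2 - 2 * rVar * potential n := by
  simp only [K, Function.iterate_succ_apply']; rfl

theorem totalD_potential (n : ℕ) :
    totalD (potential n) = rVar * (K n).1 + qVar * (K n).2 := (flow_antiD_spec n).1

theorem constantCoeff_potential (n : ℕ) : MvPolynomial.constantCoeff (potential n) = 0 :=
  constantCoeff_antiD _

theorem potential_zero : potential 0 = 0 := by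
  apply eq_of_totalD_eq
  · rw [totalD_potential]; simp [K]; ring
  · rw [constantCoeff_potential, map_zero]

/-- The potentials are differential polynomials in the lower flows. -/
theorem potential_succ (n : ℕ) :
    potential (n + 1) = ∑ p ∈ Finset.HasAntidiagonal.antidiagonal n,
      (potential p.1 * potential p.2 - (K p.1).1 * (K p.2).2) := by
  apply eq_of_totalD_eq
  -- The `K`-products telescope along the antidiagonal to `K₁,ₙ₊₁ r + q K₂,ₙ₊₁`, since `K₀ = (-q,
  -- r)`. The terms containing potentials cancel once the last family is reindexed by swapping `p`.
  · have hD : ∀ p ∈ Finset.HasAntidiagonal.antidiagonal n,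
        totalD (potential p.1 * potential p.2 - (K p.1).1 * (K p.2).2) =
          ((K (p.1 + 1)).1 * (K p.2).2 - (K p.1).1 * (K (p.2 + 1)).2)
          + (potential p.2 * (rVar * (K p.1).1 + qVar * (K p.1).2)
            - 2 * (potential p.2 * (rVar * (K p.1).1))
          + (potential p.1 * (rVar * (K p.2).1 - qVar * (K p.2).2))) := by
      intro p _
      rw [map_sub, Derivation.leibniz, Derivation.leibniz, totalD_potential, totalD_potential,
        K_succ_fst, K_succ_snd]
      simp only [smul_eq_mul]
      ring
    have hs : ∑ p ∈ Finset.HasAntidiagonal.antidiagonal n, potential p.1 * (rVar * (K p.2).1 - qVar * (K p.2).2) =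
        ∑ p ∈ Finset.HasAntidiagonal.antidiagonal n, potential p.2 * (rVar * (K p.1).1 - qVar * (K p.1).2) :=
      (Finset.Nat.sum_antidiagonal_swap (n := n)
        (f := fun p => potential p.1 * (rVar * (K p.2).1 - qVar * (K p.2).2))).symm
    have ht1 := Finset.Nat.sum_antidiagonal_succ (n := n)
      (f := fun p => (K p.1).1 * (K p.2).2)
    have ht2 := Finset.Nat.sum_antidiagonal_succ' (n := n)
      (f := fun p => (K p.1).1 * (K p.2).2)
    have hz : ∀ p ∈ Finset.HasAntidiagonal.antidiagonal n,
        potential p.2 * (rVar * (K p.1).1 + qVar * (K p.1).2)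
          - 2 * (potential p.2 * (rVar * (K p.1).1))
          + potential p.2 * (rVar * (K p.1).1 - qVar * (K p.1).2) = 0 := fun p _ => by ring
    rw [totalD_potential, map_sum, Finset.sum_congr rfl hD, Finset.sum_add_distrib,
      Finset.sum_add_distrib, hs, ← Finset.sum_add_distrib, Finset.sum_eq_zero hz, add_zero,
      Finset.sum_sub_distrib]
    have h0 : (K 0).1 = -qVar ∧ (K 0).2 = rVar := ⟨rfl, rfl⟩
    simp only [h0.1, h0.2] at ht1 ht2
    linear_combination ht1 - ht2
  · rw [constantCoeff_potential, map_sum]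
    refine (Finset.sum_eq_zero fun p _ => ?_).symm
    simp [constantCoeff_potential, (constantCoeff_K _).1]

/-! The resolvent of the spectral problem. -/

/-- Square matrices of size two. -/
abbrev Mat2 : Type := Matrix (Fin 2) (Fin 2) ℂ

/-- Pauli's third matrix. -/
def sigmaThree : Mat2 := !![1, 0; 0, -1]

@[simp] theorem sigmaThree_zero_zero : sigmaThree 0 0 = 1 := rfl
@[simp] theorem sigmaThree_zero_one : sigmaThree 0 1 = 0 := rfl
@[simp] theorem sigmaThree_one_zero : sigmaThree 1 0 = 0 := rfl
@[simp] theorem sigmaThree_one_one : sigmaThree 1 1 = -1 := rfl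

theorem sigmaThree_mul_self : sigmaThree * sigmaThree = 1 := by
  ext i j
  fin_cases i <;> fin_cases j <;> simp [Matrix.mul_apply, Fin.sum_univ_two]

/-- Entrywise derivative of a matrix valued function. -/
def HasEntryDerivAt {m n : Type*} (F : ℝ → Matrix m n ℂ) (F' : Matrix m n ℂ) (x : ℝ) : Prop :=
  ∀ i j, HasDerivAt (fun y => F y i j) (F' i j) x

/-- The coefficients of a normalized resolvent `R = σ₃ + ∑ Rₖ λ⁻ᵏ` with `R² = 1`, which solves
`R' = [R, λ σ₃ / 2 + R₁ / 2]`, are the AKNS flows. -/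
theorem resolvent_eq_flow {q r : ℝ → ℂ} {S : Set ℝ} (hS : IsOpen S)
    (hq : ∀ y ∈ S, ContDiffAt ℝ ∞ q y) (hr : ∀ y ∈ S, ContDiffAt ℝ ∞ r y)
    (R : ℝ → ℕ → Mat2) (h0 : ∀ y ∈ S, R y 0 = sigmaThree)
    (h1q : ∀ y ∈ S, R y 1 0 1 = -2 * q y) (h1r : ∀ y ∈ S, R y 1 1 0 = -2 * r y)
    (hsq : ∀ y ∈ S, ∀ k, ∑ p ∈ Finset.HasAntidiagonal.antidiagonal (k + 1), R y p.1 * R y p.2 = 0)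
    (htr : ∀ y ∈ S, ∀ k, (R y k).trace = 0)
    (hR : ∀ y ∈ S, ∀ k, HasEntryDerivAt (fun y => R y k)
      ((1 / 2 : ℂ) • (R y (k + 1) * sigmaThree - sigmaThree * R y (k + 1)
        + (R y k * R y 1 - R y 1 * R y k))) y) (n : ℕ) :
    ∀ y ∈ S, R y (n + 1) 0 1 = 2 * evalJet q r y (K n).1 ∧
      R y (n + 1) 1 0 = -2 * evalJet q r y (K n).2 ∧
      R y (n + 1) 0 0 = -2 * evalJet q r y (potential n) := by
  have eq0 : ∀ y, evalJet q r y qVar = q y := fun y => by simp [evalJet, qVar]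
  have er0 : ∀ y, evalJet q r y rVar = r y := fun y => by simp [evalJet, rVar]
  have htr' : ∀ y ∈ S, ∀ k, R y k 1 1 = -R y k 0 0 := fun y hy k => by
    have := htr y hy k
    rw [Matrix.trace_fin_two] at this
    linear_combination this
  -- The `λ⁻¹` coefficient of `R² = 1` says that `R₁` anticommutes with `σ₃`, so its diagonal
  -- vanishes.
  have h100 : ∀ y ∈ S, R y 1 0 0 = 0 := by
    intro y hy
    have := congrFun₂ (hsq y hy 0) 0 0
    simp [Finset.Nat.antidiagonal_succ, h0 y hy, Matrix.mul_apply,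
      Fin.sum_univ_two] at this
    exact this
  induction n using Nat.strong_induction_on with
  | _ n ih =>
  cases n with
  | zero =>
    intro y hy
    refine ⟨?_, ?_, ?_⟩
    · rw [h1q y hy]
      simp only [K, Function.iterate_zero, id, evalJet, map_neg] at eq0 ⊢
      rw [eq0]; ring
    · rw [h1r y hy]
      simp only [K, Function.iterate_zero, id] at er0 ⊢
      rw [er0]
    · rw [h100 y hy, potential_zero]
      simp [evalJet]
  | succ n =>
    intro y hy
    have hnear : ∀ᶠ z in nhds y, z ∈ S := hS.mem_nhds hy
    obtain ⟨i1, i2, i3⟩ := ih n (Nat.lt_succ_self n) y hy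
    have hadd : ∀ P Q, evalJet q r y (P + Q) = evalJet q r y P + evalJet q r y Q := fun P Q => by
      simp [evalJet]
    have hmul : ∀ P Q, evalJet q r y (P * Q) = evalJet q r y P * evalJet q r y Q := fun P Q => by
      simp [evalJet]
    have hneg : ∀ P, evalJet q r y (-P) = -evalJet q r y P := fun P => by simp [evalJet]
    have hsub : ∀ P Q, evalJet q r y (P - Q) = evalJet q r y P - evalJet q r y Q := fun P Q => by
      simp [evalJet]
    have h2 : evalJet q r y 2 = 2 := map_ofNat (MvPolynomial.eval _) 2
    refine ⟨?_, ?_, ?_⟩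
    · have e : (fun z => R z (n + 1) 0 1) =ᶠ[nhds y] fun z => 2 * evalJet q r z (K n).1 :=
        hnear.mono fun z hz => (ih n (Nat.lt_succ_self n) z hz).1
      have d := (hR y hy (n + 1) 0 1).unique
        (((hasDerivAt_evalJet (hq y hy) (hr y hy) (K n).1).const_mul 2).congr_of_eventuallyEq e)
      simp [Matrix.mul_apply, Fin.sum_univ_two, htr' y hy, h100 y hy, h1q y hy, i3]
        at d
      rw [K_succ_fst, hadd, hneg, hmul, hmul, eq0, h2]
      linear_combination -d
    · have e : (fun z => R z (n + 1) 1 0) =ᶠ[nhds y] fun z => -2 * evalJet q r z (K n).2 :=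
        hnear.mono fun z hz => (ih n (Nat.lt_succ_self n) z hz).2.1
      have d := (hR y hy (n + 1) 1 0).unique
        (((hasDerivAt_evalJet (hq y hy) (hr y hy) (K n).2).const_mul (-2)).congr_of_eventuallyEq e)
      simp [Matrix.mul_apply, Fin.sum_univ_two, htr' y hy, h100 y hy, h1r y hy, i3]
        at d
      rw [K_succ_snd, hsub, hmul, hmul, er0, h2]
      linear_combination d
    -- The two end terms of this coefficient of `R² = 1` contribute `2 (R_{n+2})₀₀`. The inner terms
    -- involve only earlier coefficients and sum to four times the right-hand side of
    -- `potential_succ`, so no integration constant can enter.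
    · have s := congrFun₂ (hsq y hy (n + 1)) 0 0
      rw [Finset.Nat.antidiagonal_succ_succ'] at s
      simp [h0 y hy, Matrix.mul_apply, Matrix.sum_apply, Fin.sum_univ_two] at s
      have t : ∑ p ∈ Finset.HasAntidiagonal.antidiagonal n, (R y (p.1 + 1) 0 0 * R y (p.2 + 1) 0 0
          + R y (p.1 + 1) 0 1 * R y (p.2 + 1) 1 0) = 4 * evalJet q r y (potential (n + 1)) := by
        rw [potential_succ]
        simp only [evalJet, map_sum, Finset.mul_sum]
        refine Finset.sum_congr rfl fun p hp => ?_
        have hp' := Finset.HasAntidiagonal.mem_antidiagonal.mp hp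
        obtain ⟨a1, a2, a3⟩ := ih p.1 (by omega) y hy
        obtain ⟨b1, b2, b3⟩ := ih p.2 (by omega) y hy
        rw [a1, a3, b2, b3]
        simp only [evalJet, map_sub, map_mul]
        ring
      rw [t] at s
      linear_combination s / 2

theorem HasEntryDerivAt.mul {l m n : Type*} [Fintype m] {F : ℝ → Matrix l m ℂ}
    {G : ℝ → Matrix m n ℂ} {F' : Matrix l m ℂ} {G' : Matrix m n ℂ} {x : ℝ}
    (hF : HasEntryDerivAt F F' x) (hG : HasEntryDerivAt G G' x) :
    HasEntryDerivAt (fun y => F y * G y) (F' * G x + F x * G') x := by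
  intro i j
  simp only [Matrix.mul_apply, Matrix.add_apply, ← Finset.sum_add_distrib]
  exact HasDerivAt.fun_sum fun k _ => (hF i k).fun_mul (hG k j)

theorem hasEntryDerivAt_const {m n : Type*} (F : Matrix m n ℂ) (x : ℝ) :
    HasEntryDerivAt (fun _ => F) 0 x := fun i j => hasDerivAt_const x (F i j)

theorem HasEntryDerivAt.sum {ι m n : Type*} {s : Finset ι} {F : ι → ℝ → Matrix m n ℂ}
    {F' : ι → Matrix m n ℂ} {x : ℝ} (h : ∀ a ∈ s, HasEntryDerivAt (F a) (F' a) x) :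
    HasEntryDerivAt (fun y => ∑ a ∈ s, F a y) (∑ a ∈ s, F' a) x := by
  intro i j
  simp only [Matrix.sum_apply]
  exact HasDerivAt.fun_sum fun a ha => h a ha i j

theorem HasEntryDerivAt.sub {m n : Type*} {F G : ℝ → Matrix m n ℂ} {F' G' : Matrix m n ℂ} {x : ℝ}
    (hF : HasEntryDerivAt F F' x) (hG : HasEntryDerivAt G G' x) :
    HasEntryDerivAt (fun y => F y - G y) (F' - G') x := fun i j => (hF i j).fun_sub (hG i j)

theorem HasEntryDerivAt.unique {m n : Type*} {F : ℝ → Matrix m n ℂ} {F' F'' : Matrix m n ℂ}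
    {x : ℝ} (h' : HasEntryDerivAt F F' x) (h'' : HasEntryDerivAt F F'' x) : F' = F'' := by
  ext i j
  exact (h' i j).unique (h'' i j)

theorem HasEntryDerivAt.congr_of_eventuallyEq {m n : Type*} {F G : ℝ → Matrix m n ℂ}
    {F' : Matrix m n ℂ} {x : ℝ} (h : HasEntryDerivAt F F' x) (e : G =ᶠ[nhds x] F) :
    HasEntryDerivAt G F' x := fun i j =>
  (h i j).congr_of_eventuallyEq (e.mono fun y hy => by simp only [hy])

/-! Formal power series in `λ⁻¹` with matrix coefficients. -/

/-- Coefficientwise derivative of a function with values in power series. -/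
def HasCoeffDerivAt (P : ℝ → PowerSeries Mat2) (P' : PowerSeries Mat2) (x : ℝ) : Prop :=
  ∀ k, HasEntryDerivAt (fun y => PowerSeries.coeff k (P y)) (PowerSeries.coeff k P') x

theorem HasCoeffDerivAt.mul {P Q : ℝ → PowerSeries Mat2} {P' Q' : PowerSeries Mat2} {x : ℝ}
    (hP : HasCoeffDerivAt P P' x) (hQ : HasCoeffDerivAt Q Q' x) :
    HasCoeffDerivAt (fun y => P y * Q y) (P' * Q x + P x * Q') x := by
  intro k
  simp only [PowerSeries.coeff_mul, map_add, ← Finset.sum_add_distrib]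
  exact HasEntryDerivAt.sum fun p _ => (hP p.1).mul (hQ p.2)

theorem hasCoeffDerivAt_const (P : PowerSeries Mat2) (x : ℝ) :
    HasCoeffDerivAt (fun _ => P) 0 x := fun k => by
  simpa using hasEntryDerivAt_const (PowerSeries.coeff k P) x

theorem HasCoeffDerivAt.unique {P : ℝ → PowerSeries Mat2} {P' P'' : PowerSeries Mat2} {x : ℝ}
    (h' : HasCoeffDerivAt P P' x) (h'' : HasCoeffDerivAt P P'' x) : P' = P'' := by
  ext1 k
  exact (h' k).unique (h'' k)

/-- The inverse of a differentiable power series with constant coefficient one is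
differentiable. -/
theorem exists_hasCoeffDerivAt_of_mul {P Q Z : ℝ → PowerSeries Mat2} {P' Z' : PowerSeries Mat2}
    {x : ℝ} (hP : HasCoeffDerivAt P P' x) (hZ : HasCoeffDerivAt Z Z' x)
    (h0 : ∀ y, PowerSeries.coeff 0 (P y) = 1) (hPQ : ∀ y, P y * Q y = Z y) :
    ∃ Q', HasCoeffDerivAt Q Q' x := by
  have key : ∀ k, ∃ D, HasEntryDerivAt (fun y => PowerSeries.coeff k (Q y)) D x := by
    intro k
    induction k using Nat.strong_induction_on with
    | _ k ih =>
    cases k with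
    | zero =>
      refine ⟨_, (hZ 0).congr_of_eventuallyEq (Filter.Eventually.of_forall fun y => ?_)⟩
      have := congrArg (PowerSeries.coeff 0) (hPQ y)
      simpa [PowerSeries.coeff_mul, h0 y] using this
    | succ k =>
      choose! D hD using ih
      -- Because `P` has constant coefficient one, the coefficient `k + 1` of `Q` is that of `Z`
      -- minus products of coefficients of `P` with lower coefficients of `Q`.
      refine ⟨_, ((hZ (k + 1)).sub (HasEntryDerivAt.sum (s := Finset.HasAntidiagonal.antidiagonal k)
        fun p hp => (hP (p.1 + 1)).mul (hD p.2 (by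
          have := Finset.HasAntidiagonal.mem_antidiagonal.mp hp
          omega)))).congr_of_eventuallyEq (Filter.Eventually.of_forall fun y => ?_)⟩
      have := congrArg (PowerSeries.coeff (k + 1)) (hPQ y)
      rw [PowerSeries.coeff_mul, Finset.Nat.antidiagonal_succ, Finset.sum_cons, Finset.sum_map,
        h0 y, one_mul] at this
      exact eq_sub_of_add_eq this
  choose D hD using key
  exact ⟨PowerSeries.mk D, fun k => by simpa using hD k⟩

/-- The conjugate `m⁻¹ σ₃ m` of `σ₃` by a power series with constant coefficient one. -/
def resolvent (m : PowerSeries Mat2) : PowerSeries Mat2 :=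
  PowerSeries.invOfUnit m 1 * PowerSeries.C sigmaThree * m

section
variable {m : PowerSeries Mat2} (hm : PowerSeries.constantCoeff m = 1)
include hm

theorem mul_resolvent : m * resolvent m = PowerSeries.C sigmaThree * m := by
  rw [resolvent, ← mul_assoc, ← mul_assoc, PowerSeries.mul_invOfUnit m 1 (by simpa using hm),
    one_mul]

theorem resolvent_mul_self : resolvent m * resolvent m = 1 := by
  have h := PowerSeries.mul_invOfUnit m 1 (by simpa using hm)
  have h' := PowerSeries.invOfUnit_mul m 1 (by simpa using hm)
  have hs : PowerSeries.C sigmaThree * PowerSeries.C sigmaThree = (1 : PowerSeries Mat2) := by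
    rw [← map_mul, sigmaThree_mul_self, map_one]
  calc resolvent m * resolvent m
      = PowerSeries.invOfUnit m 1 * PowerSeries.C sigmaThree * (m * PowerSeries.invOfUnit m 1)
        * PowerSeries.C sigmaThree * m := by simp only [resolvent, mul_assoc]
    _ = 1 := by rw [h, mul_one, mul_assoc (PowerSeries.invOfUnit m 1), hs, mul_one, h']

theorem coeff_zero_resolvent : PowerSeries.coeff 0 (resolvent m) = sigmaThree := by
  have h := congrArg PowerSeries.constantCoeff (mul_resolvent hm)
  simpa [hm] using h

/-- The commutator with `σ₃` kills the diagonal of `m₁` and doubles the off-diagonal entries up to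
sign. This is how `q` and `r` enter `R₁`. -/
theorem coeff_one_resolvent : PowerSeries.coeff 1 (resolvent m) =
    sigmaThree * PowerSeries.coeff 1 m - PowerSeries.coeff 1 m * sigmaThree := by
  have h := congrArg (PowerSeries.coeff 1) (mul_resolvent hm)
  rw [PowerSeries.coeff_mul, Finset.Nat.antidiagonal_succ, Finset.sum_cons] at h
  simp [hm, coeff_zero_resolvent hm, PowerSeries.coeff_C_mul] at h
  exact eq_sub_of_add_eq h

/-- Cyclicity of the trace, applied coefficient by coefficient, replaces `m⁻¹ σ₃ m` by `σ₃ m m⁻¹ =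
σ₃`. -/
theorem trace_coeff_resolvent (k : ℕ) : (PowerSeries.coeff k (resolvent m)).trace = 0 := by
  have hc : (PowerSeries.coeff k (resolvent m)).trace =
      (PowerSeries.coeff k (PowerSeries.C sigmaThree * m * PowerSeries.invOfUnit m 1)).trace := by
    rw [resolvent, mul_assoc, PowerSeries.coeff_mul, PowerSeries.coeff_mul, Matrix.trace_sum,
      Matrix.trace_sum, ← Finset.Nat.sum_antidiagonal_swap]
    exact Finset.sum_congr rfl fun p _ => Matrix.trace_mul_comm _ _
  rw [hc, mul_assoc, PowerSeries.mul_invOfUnit m 1 (by simpa using hm), mul_one,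
    PowerSeries.coeff_C]
  split_ifs <;> simp [Matrix.trace_fin_two]

end

/-- The power series `∑ p_{k+n} Xᵏ`. -/
def shift (n : ℕ) (p : PowerSeries Mat2) : PowerSeries Mat2 :=
  PowerSeries.mk fun k => PowerSeries.coeff (k + n) p

theorem shift_zero (p : PowerSeries Mat2) : shift 0 p = p := by
  ext1 k; simp [shift]

theorem shift_eq (n : ℕ) (p : PowerSeries Mat2) :
    shift n p = PowerSeries.C (PowerSeries.coeff n p) + PowerSeries.X * shift (n + 1) p := by
  ext1 k
  cases k with
  | zero => simp [shift]
  | succ k => simp [shift, PowerSeries.coeff_succ_X_mul, add_right_comm]; rfl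

theorem mul_shift_eq (m p : PowerSeries Mat2) (n : ℕ) :
    m * shift n p = m * PowerSeries.C (PowerSeries.coeff n p)
      + PowerSeries.X * (m * shift (n + 1) p) := by
  rw [shift_eq n p, mul_add, ← mul_assoc, ← mul_assoc, (PowerSeries.commute_X m).eq]

/-! ### Evaluation of matrix polynomials in `λ` at `A`, and the flow of the annihilating polynomial
-/

section
variable {ι : Type*} [Fintype ι] [DecidableEq ι]

/-- The value of the truncated polynomial `λᴰ p(λ⁻¹)`, with the powers of `λ` replaced by the
matrices `Aᵏ Φ`. -/
def evalAt (A : Matrix ι ι ℂ) (Φ : Matrix ι (Fin 2) ℂ) (D : ℕ) (p : PowerSeries Mat2) :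
    Matrix ι (Fin 2) ℂ :=
  ∑ k ∈ Finset.HasAntidiagonal.antidiagonal D, A ^ k.1 * Φ * PowerSeries.coeff k.2 p

variable (A : Matrix ι ι ℂ) (Φ : Matrix ι (Fin 2) ℂ)

theorem evalAt_add (D : ℕ) (p q : PowerSeries Mat2) :
    evalAt A Φ D (p + q) = evalAt A Φ D p + evalAt A Φ D q := by
  simp [evalAt, Finset.sum_add_distrib, Matrix.mul_add]

theorem evalAt_mul_C (D : ℕ) (p : PowerSeries Mat2) (a : Mat2) :
    evalAt A Φ D (p * PowerSeries.C a) = evalAt A Φ D p * a := by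
  simp [evalAt, PowerSeries.coeff_mul_C, Matrix.sum_mul, Matrix.mul_assoc]

theorem evalAt_smul (D : ℕ) (p : PowerSeries Mat2) (c : ℂ) :
    evalAt A Φ D (PowerSeries.C (c • (1 : Mat2)) * p) = c • evalAt A Φ D p := by
  simp [evalAt, PowerSeries.coeff_C_mul, Finset.smul_sum]

/-- `X` stands for `λ⁻¹`, so it cancels one power of the prefactor `λᴰ`. -/
theorem evalAt_X_mul (D : ℕ) (p : PowerSeries Mat2) :
    evalAt A Φ (D + 1) (PowerSeries.X * p) = evalAt A Φ D p := by
  simp [evalAt, Finset.Nat.sum_antidiagonal_succ', PowerSeries.coeff_succ_X_mul]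

/-- The vanishing beyond `D` means that `λᴰ p` has no negative powers, so nothing is lost by
truncation and `λⁿ` comes out as `Aⁿ`. -/
theorem evalAt_add_right {D : ℕ} {p : PowerSeries Mat2}
    (hp : ∀ k, D < k → PowerSeries.coeff k p = 0) (n : ℕ) :
    evalAt A Φ (D + n) p = A ^ n * evalAt A Φ D p := by
  induction n with
  | zero => simp
  | succ n ih =>
    rw [pow_succ', Matrix.mul_assoc, ← ih, evalAt, ← add_assoc, Finset.Nat.sum_antidiagonal_succ,
      hp (D + n + 1) (by omega), evalAt, Matrix.mul_sum]
    simp [pow_succ', Matrix.mul_assoc]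

/-- The polynomial part of `λⁿ R` contributes sums of `λⁱ m a` with constant `a`, each of which
evaluates to `Aⁱ` times the value of `m` times `a`, that is, to zero. Only the shifted tail of `R`
remains. -/
theorem evalAt_mul_shift {N : ℕ} {m : PowerSeries Mat2}
    (hdeg : ∀ k, N < k → PowerSeries.coeff k m = 0) (hker : evalAt A Φ N m = 0)
    (R : PowerSeries Mat2) (n : ℕ) : ∀ D, evalAt A Φ (N + D + n) (m * R) =
      evalAt A Φ (N + D) (m * shift n R) := by
  induction n with
  | zero => intro D; rw [shift_zero, add_zero]
  | succ n ih =>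
    intro D
    have h := ih (D + 1)
    rw [mul_shift_eq, evalAt_add, evalAt_mul_C, evalAt_add_right A Φ hdeg, hker,
      ← add_assoc N D 1, evalAt_X_mul, Matrix.mul_zero, Matrix.zero_mul, zero_add] at h
    rw [← h]
    congr 1
    omega

/-- Peeling one coefficient off `R` subtracts a right multiple of `m`, which has degree at most `N`
in `λ⁻¹`. Dividing by `X` then lowers the bound by one, from vanishing beyond `N` to vanishing from
`N` on. -/
theorem coeff_mul_shift {N : ℕ} {m R : PowerSeries Mat2}
    (hdeg : ∀ k, N < k → PowerSeries.coeff k m = 0)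
    (hR : ∀ k, N < k → PowerSeries.coeff k (m * R) = 0) (n : ℕ) :
    ∀ k, N ≤ k → PowerSeries.coeff k (m * shift (n + 1) R) = 0 := by
  have step : ∀ n, (∀ k, N < k → PowerSeries.coeff k (m * shift n R) = 0) →
      ∀ k, N ≤ k → PowerSeries.coeff k (m * shift (n + 1) R) = 0 := by
    intro n h k hk
    have := h (k + 1) (by omega)
    rwa [mul_shift_eq, map_add, PowerSeries.coeff_mul_C, hdeg _ (by omega), zero_mul, zero_add,
      PowerSeries.coeff_succ_X_mul] at this
  induction n with
  | zero => exact step 0 (by rwa [shift_zero])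
  | succ n ih => exact step (n + 1) fun k hk => ih k hk.le

variable {A}

/-- The evolution of the dressing polynomial, if `Φ' = c Aⁿ Φ σ₃`. -/
theorem dressing_flow {Φ : ℝ → Matrix ι (Fin 2) ℂ} {m : ℝ → PowerSeries Mat2}
    {m' : PowerSeries Mat2} {x : ℝ} {N n : ℕ} {c : ℂ}
    (h0 : PowerSeries.constantCoeff (m x) = 1)
    (hdeg : ∀ k, N + 1 < k → PowerSeries.coeff k (m x) = 0)
    (h0' : PowerSeries.coeff 0 m' = 0)
    (hdeg' : ∀ k, N + 1 < k → PowerSeries.coeff k m' = 0)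
    (hker : ∀ᶠ y in nhds x, evalAt A (Φ y) (N + 1) (m y) = 0)
    (hind : ∀ p, evalAt A (Φ x) N p = 0 → ∀ k ≤ N, PowerSeries.coeff k p = 0)
    (hΦ : HasEntryDerivAt Φ (c • (A ^ n * Φ x * sigmaThree)) x) (hm : HasCoeffDerivAt m m' x) :
    m' = -(PowerSeries.C (c • (1 : Mat2)) *
      (PowerSeries.X * (m x * shift (n + 1) (resolvent (m x))))) := by
  set R := resolvent (m x) with hRdef
  have hmR : m x * R = PowerSeries.C sigmaThree * m x := mul_resolvent h0
  have hsdeg : ∀ k, N + 1 < k → PowerSeries.coeff k (PowerSeries.C sigmaThree * m x) = 0 := by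
    intro k hk
    rw [PowerSeries.coeff_C_mul, hdeg k hk, mul_zero]
  have hd : HasEntryDerivAt (fun y => evalAt A (Φ y) (N + 1) (m y))
      (c • (A ^ n * evalAt A (Φ x) (N + 1) (PowerSeries.C sigmaThree * m x))
        + evalAt A (Φ x) (N + 1) m') x := by
    have e : c • (A ^ n * evalAt A (Φ x) (N + 1) (PowerSeries.C sigmaThree * m x))
        + evalAt A (Φ x) (N + 1) m' = ∑ k ∈ Finset.HasAntidiagonal.antidiagonal (N + 1),
          (((0 : Matrix ι ι ℂ) * Φ x + A ^ k.1 * (c • (A ^ n * Φ x * sigmaThree))) * PowerSeries.coeff k.2 (m x)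
            + A ^ k.1 * Φ x * PowerSeries.coeff k.2 m') := by
      rw [Finset.sum_add_distrib, evalAt, evalAt, Matrix.mul_sum, Finset.smul_sum]
      congr 1
      refine Finset.sum_congr rfl fun k _ => ?_
      rw [Matrix.zero_mul, zero_add, Matrix.mul_smul, Matrix.smul_mul, PowerSeries.coeff_C_mul]
      simp only [← Matrix.mul_assoc, ← pow_add, add_comm n]
    rw [e]
    exact HasEntryDerivAt.sum fun k _ => ((hasEntryDerivAt_const _ x).mul hΦ).mul (hm k.2)
  -- The annihilation relation holds near `x`, so its derivative vanishes. Here `Φ'` puts `σ₃` in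
  -- front of `m` and `Aⁿ` in front of the whole value.
  have hz : c • (A ^ n * evalAt A (Φ x) (N + 1) (PowerSeries.C sigmaThree * m x))
        + evalAt A (Φ x) (N + 1) m' = 0 :=
    hd.unique ((hasEntryDerivAt_const 0 x).congr_of_eventuallyEq hker)
  have hX : m' = PowerSeries.X * shift 1 m' := by
    have := shift_eq 0 m'
    rwa [shift_zero, h0', map_zero, zero_add, zero_add] at this
  -- Since `σ₃ m = m R`, the term `Aⁿ` times the value of `σ₃ m` equals the value of `m` times the
  -- negative part of `λⁿ R`, with one factor `X` removed.
  have hs := evalAt_mul_shift A (Φ x) hdeg hker.self_of_nhds R n 0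
  rw [mul_shift_eq, evalAt_add, evalAt_mul_C, add_zero, hker.self_of_nhds, Matrix.zero_mul,
    zero_add, evalAt_X_mul, hmR, evalAt_add_right A _ hsdeg] at hs
  rw [hs, hX, evalAt_X_mul, ← evalAt_smul, ← evalAt_add] at hz
  -- Coefficients above `N` vanish by the degree bounds. Those up to `N` vanish because a polynomial
  -- of degree at most `N` that annihilates `Φ` is zero.
  have hvan : ∀ k, PowerSeries.coeff k (PowerSeries.C (c • (1 : Mat2)) *
      (m x * shift (n + 1) R) + shift 1 m') = 0 := by
    intro k
    rcases Nat.lt_or_ge N k with hk | hk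
    · have h1 : PowerSeries.coeff k (shift 1 m') = 0 := by
        simpa [shift] using hdeg' (k + 1) (by omega)
      rw [map_add, PowerSeries.coeff_C_mul, h1, coeff_mul_shift hdeg (by rwa [hmR]) n k hk,
        mul_zero, add_zero]
    · exact hind _ hz k hk
  have hsh : shift 1 m' = -(PowerSeries.C (c • (1 : Mat2)) * (m x * shift (n + 1) R)) := by
    rw [← add_eq_zero_iff_eq_neg']
    ext1 k
    simpa using hvan k
  rw [hX, hsh, mul_neg, ← mul_assoc,
    ← (PowerSeries.commute_X (PowerSeries.C (c • (1 : Mat2)))).eq, mul_assoc]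

end

/-- The evolution of the resolvent under the first flow. -/
theorem hasCoeffDerivAt_resolvent {m : ℝ → PowerSeries Mat2} {m' : PowerSeries Mat2} {x : ℝ}
    (h0 : ∀ y, PowerSeries.constantCoeff (m y) = 1) (hm : HasCoeffDerivAt m m' x)
    (hm' : m' = -(PowerSeries.C ((1 / 2 : ℂ) • (1 : Mat2)) *
      (PowerSeries.X * (m x * shift 2 (resolvent (m x)))))) (k : ℕ) :
    HasEntryDerivAt (fun y => PowerSeries.coeff k (resolvent (m y)))
      ((1 / 2 : ℂ) • (PowerSeries.coeff (k + 1) (resolvent (m x)) * sigmaThree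
        - sigmaThree * PowerSeries.coeff (k + 1) (resolvent (m x))
        + (PowerSeries.coeff k (resolvent (m x)) * PowerSeries.coeff 1 (resolvent (m x))
        - PowerSeries.coeff 1 (resolvent (m x)) * PowerSeries.coeff k (resolvent (m x))))) x := by
  set R := fun y => resolvent (m y) with hRdef
  have hmR : ∀ y, m y * R y = PowerSeries.C sigmaThree * m y := fun y => mul_resolvent (h0 y)
  have hsm : HasCoeffDerivAt (fun y => PowerSeries.C sigmaThree * m y)
      (PowerSeries.C sigmaThree * m') x := by
    simpa using (hasCoeffDerivAt_const (PowerSeries.C sigmaThree) x).mul hm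
  obtain ⟨R', hR'⟩ := exists_hasCoeffDerivAt_of_mul (Q := R) hm hsm
    (fun y => by simpa using h0 y) hmR
  -- Differentiating `m R = σ₃ m` gives `m' R + m R' = σ₃ m'`.
  have hprod := (hm.mul hR').unique (show HasCoeffDerivAt (fun y => m y * R y) _ x by
    simpa only [hmR] using hsm)
  have hdec : R x = PowerSeries.C sigmaThree + PowerSeries.X *
      (PowerSeries.C (PowerSeries.coeff 1 (R x)) + PowerSeries.X * shift 2 (R x)) := by
    rw [← shift_eq, ← coeff_zero_resolvent (h0 x), ← shift_eq, shift_zero]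
  have hmr := hmR x
  have hsq : R x * R x = 1 := resolvent_mul_self (h0 x)
  have hinv := PowerSeries.invOfUnit_mul (m x) 1 (by simpa using h0 x)
  have hX : ∀ p : PowerSeries Mat2, p * PowerSeries.X = PowerSeries.X * p := fun p =>
    (PowerSeries.commute_X p).eq
  have hc : ∀ p : PowerSeries Mat2, p * PowerSeries.C ((1 / 2 : ℂ) • (1 : Mat2)) =
      PowerSeries.C ((1 / 2 : ℂ) • (1 : Mat2)) * p := fun p => by
    ext1 k; simp [PowerSeries.coeff_C_mul, PowerSeries.coeff_mul_C]
  -- `U` is `λ⁻¹(λ σ₃ + R₁)`. All identities are multiplied by `X = λ⁻¹` so that no positive power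
  -- of `λ` occurs. Then `X m' = -(1/2) m (R - U)`, and the target is `X R' = (1/2)[R, U]`.
  set c := PowerSeries.C ((1 / 2 : ℂ) • (1 : Mat2)) with hcdef
  set U := PowerSeries.C sigmaThree + PowerSeries.X * PowerSeries.C (PowerSeries.coeff 1 (R x))
    with hU
  have hS : PowerSeries.X * (PowerSeries.X * shift 2 (R x)) = R x - U := by
    conv_rhs => rw [hdec]
    rw [hU, mul_add]
    abel
  have e1 : PowerSeries.X * m' = -(c * (m x * (R x - U))) := by
    rw [hm', mul_neg, ← mul_assoc, ← hX c, mul_assoc, ← mul_assoc PowerSeries.X (m x),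
      ← hX (m x), mul_assoc (m x), ← mul_assoc PowerSeries.X (m x), ← hX (m x),
      mul_assoc (m x), hS]
  have e2 : m x * (PowerSeries.X * R') = m x * (c * (R x * U - U * R x)) := by
    calc m x * (PowerSeries.X * R') = PowerSeries.X * (m' * R x + m x * R')
          - PowerSeries.X * m' * R x := by
            rw [mul_add, ← mul_assoc, hX, mul_assoc, mul_assoc]; abel
      _ = PowerSeries.C sigmaThree * (PowerSeries.X * m') - PowerSeries.X * m' * R x := by
            rw [hprod, ← mul_assoc, ← hX, mul_assoc]
      _ = c * (m x * (R x - U) * R x) - c * (PowerSeries.C sigmaThree * m x * (R x - U)) := by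
            rw [e1, mul_neg, ← mul_assoc, hc, neg_mul]
            simp only [mul_assoc]; abel
      _ = c * (m x * (R x * U - U * R x)) := by
            rw [← hmR x, ← mul_sub]
            congr 1
            noncomm_ring
      _ = m x * (c * (R x * U - U * R x)) := by rw [← mul_assoc, ← hc, mul_assoc]
  have e3 : PowerSeries.X * R' = c * (R x * U - U * R x) := by
    have := congrArg (fun p => PowerSeries.invOfUnit (m x) 1 * p) e2
    simpa only [← mul_assoc, hinv, one_mul] using this
  have e4 := congrArg (PowerSeries.coeff (k + 1)) e3
  rw [PowerSeries.coeff_succ_X_mul, hcdef, PowerSeries.coeff_C_mul, hU, mul_add, add_mul,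
    ← mul_assoc, hX (R x), mul_assoc, mul_assoc] at e4
  simp only [map_sub, map_add, PowerSeries.coeff_C_mul, PowerSeries.coeff_mul_C,
    PowerSeries.coeff_succ_X_mul] at e4
  have e5 := hR' k
  rw [e4] at e5
  convert e5 using 1
  rw [Matrix.smul_mul, Matrix.one_mul]
  congr 1
  abel

/-! ### Double Wronskians, Cramer's rule and the annihilating polynomial -/

/-- The factors `±1/2` which relate `∂ₓ` to the matrix `A` on the two columns of `Φ`. -/
def halfSign : Fin 2 → ℂ := ![1 / 2, -(1 / 2)]

theorem halfSign_ne_zero (c : Fin 2) : halfSign c ≠ 0 := by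
  fin_cases c <;> simp [halfSign]

/-- The matrix of the double Wronskian, with `∂ₓ` replaced by `±A / 2`. -/
def wronskianMat {n : ℕ} (A : Matrix (Fin n) (Fin n) ℂ) (Φ : Matrix (Fin n) (Fin 2) ℂ) (a : ℕ) :
    Matrix (Fin n) (Fin n) ℂ :=
  Matrix.of fun i j =>
    if (j : ℕ) < a then halfSign 0 ^ (j : ℕ) * (A ^ (j : ℕ) * Φ) i 0
    else halfSign 1 ^ (j - a : ℕ) * (A ^ (j - a : ℕ) * Φ) i 1

section
variable {N : ℕ} (A : Matrix (Fin (2 * N)) (Fin (2 * N)) ℂ) (Φ : Matrix (Fin (2 * N)) (Fin 2) ℂ)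

theorem wronskianMat_apply (i : Fin (2 * N)) (c : Fin 2) (k : Fin N) :
    wronskianMat A Φ N i (finProdFinEquiv (c, k)) =
      halfSign c ^ (k : ℕ) * (A ^ (k : ℕ) * Φ) i c := by
  fin_cases c <;> simp [wronskianMat, finProdFinEquiv]

theorem wronskianMat_mulVec (v : Fin (2 * N) → ℂ) (i : Fin (2 * N)) :
    (wronskianMat A Φ N *ᵥ v) i = ∑ k : Fin N, ∑ c : Fin 2,
      (A ^ (k : ℕ) * Φ) i c * (halfSign c ^ (k : ℕ) * v (finProdFinEquiv (c, k))) := by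
  rw [Matrix.mulVec, dotProduct, ← finProdFinEquiv.sum_comp, Fintype.sum_prod_type_right]
  refine Finset.sum_congr rfl fun k _ => Finset.sum_congr rfl fun c _ => ?_
  rw [wronskianMat_apply]
  ring

/-- The Wronskian is nonzero iff the columns of `Φ, AΦ, …` are independent. -/
theorem det_wronskianMat_ne_zero_iff : (wronskianMat A Φ N).det ≠ 0 ↔
    ∀ p : ℕ → Mat2, ∑ k ∈ Finset.range N, A ^ k * Φ * p k = 0 → ∀ k < N, p k = 0 := by
  constructor
  · intro hdet p hp k hk
    ext a b
    have hv : wronskianMat A Φ N *ᵥ (fun j => (halfSign (finProdFinEquiv.symm j).1)⁻¹ ^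
        ((finProdFinEquiv.symm j).2 : ℕ) *
          p (finProdFinEquiv.symm j).2 (finProdFinEquiv.symm j).1 b) = 0 := by
      ext i
      rw [wronskianMat_mulVec]
      have := congrFun₂ hp i b
      rw [Finset.sum_range, Matrix.sum_apply] at this
      rw [Pi.zero_apply, ← Matrix.zero_apply (α := ℂ) i b, ← this]
      refine Finset.sum_congr rfl fun k _ => ?_
      rw [Matrix.mul_apply]
      refine Finset.sum_congr rfl fun c _ => ?_
      rw [Equiv.symm_apply_apply, ← mul_assoc (halfSign c ^ _), ← mul_pow,
        mul_inv_cancel₀ (halfSign_ne_zero c), one_pow, one_mul]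
    have h0 := congrFun (Matrix.eq_zero_of_mulVec_eq_zero hdet hv) (finProdFinEquiv (a, ⟨k, hk⟩))
    rw [Equiv.symm_apply_apply, Pi.zero_apply] at h0
    exact (mul_eq_zero.mp h0).resolve_left (pow_ne_zero _ (inv_ne_zero (halfSign_ne_zero a)))
  · intro h hdet
    obtain ⟨v, hv0, hv⟩ := Matrix.exists_mulVec_eq_zero_iff.mpr hdet
    apply hv0
    have hp := h (fun k => Matrix.of fun a _ =>
      if hk : k < N then halfSign a ^ k * v (finProdFinEquiv (a, ⟨k, hk⟩)) else 0) (by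
        ext i b
        rw [Finset.sum_range, Matrix.sum_apply, Matrix.zero_apply, ← Pi.zero_apply (M := fun _ => ℂ) i,
          ← hv, wronskianMat_mulVec]
        refine Finset.sum_congr rfl fun k _ => ?_
        rw [Matrix.mul_apply]
        exact Finset.sum_congr rfl fun c _ => by simp)
    ext j
    obtain ⟨⟨a, k⟩, rfl⟩ := finProdFinEquiv.surjective j
    have := congrFun₂ (hp k k.2) a 0
    simp only [Matrix.of_apply, k.2, dite_true, Matrix.zero_apply] at this
    exact (mul_eq_zero.mp this).resolve_left (pow_ne_zero _ (halfSign_ne_zero a))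

/-- The coordinates of the column `b` of `Aᴺ Φ` in the basis of the columns of the Wronskian. -/
def dressingCoord (b : Fin 2) (j : Fin (2 * N)) : ℂ :=
  ((wronskianMat A Φ N).updateCol j fun i => (A ^ N * Φ) i b).det / (wronskianMat A Φ N).det

/-- The monic polynomial `λᴺ + …` that annihilates `Φ`, divided by `λᴺ` and written in `λ⁻¹`. -/
def dressing : PowerSeries Mat2 :=
  PowerSeries.mk fun j => match j with
    | 0 => 1
    | j + 1 => if h : j < N then Matrix.of fun a b =>
        -(halfSign a ^ ((⟨j, h⟩ : Fin N).rev : ℕ) *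
          dressingCoord A Φ b (finProdFinEquiv (a, (⟨j, h⟩ : Fin N).rev))) else 0

theorem coeff_zero_dressing : PowerSeries.coeff 0 (dressing A Φ) = 1 := by
  simp [dressing]

theorem constantCoeff_dressing : PowerSeries.constantCoeff (dressing A Φ) = 1 := by
  rw [← PowerSeries.coeff_zero_eq_constantCoeff_apply, coeff_zero_dressing]

theorem coeff_dressing_of_lt {k : ℕ} (hk : N < k) : PowerSeries.coeff k (dressing A Φ) = 0 := by
  obtain ⟨k, rfl⟩ : ∃ j, k = j + 1 := ⟨k - 1, by omega⟩
  simp [dressing, show ¬ k < N by omega]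

/-- Division by `λᴺ` reverses indices: the coefficient of `λᵏ` in the monic polynomial stands at
`λ^{-(N-k)}`. -/
theorem coeff_dressing (k : Fin N) (a b : Fin 2) :
    PowerSeries.coeff (N - k) (dressing A Φ) a b =
      -(halfSign a ^ (k : ℕ) * dressingCoord A Φ b (finProdFinEquiv (a, k))) := by
  obtain ⟨j, rfl⟩ : ∃ j : Fin N, k = j.rev := ⟨k.rev, (Fin.rev_rev k).symm⟩
  have : N - (j.rev : ℕ) = j + 1 := by rw [Fin.val_rev]; omega
  rw [this]
  simp [dressing]

theorem evalAt_eq_sum_range (D : ℕ) (p : PowerSeries Mat2) : evalAt A Φ D p =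
    ∑ k ∈ Finset.range (D + 1), A ^ k * Φ * PowerSeries.coeff (D - k) p :=
  Finset.Nat.sum_antidiagonal_eq_sum_range_succ_mk _ _

variable {A Φ}

theorem wronskianMat_mulVec_dressingCoord (hdet : (wronskianMat A Φ N).det ≠ 0) (b : Fin 2) :
    wronskianMat A Φ N *ᵥ dressingCoord A Φ b = fun i => (A ^ N * Φ) i b := by
  have h := Matrix.mulVec_cramer (wronskianMat A Φ N) fun i => (A ^ N * Φ) i b
  have e : dressingCoord A Φ b = (wronskianMat A Φ N).det⁻¹ •
      Matrix.cramer (wronskianMat A Φ N) fun i => (A ^ N * Φ) i b := by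
    ext j
    rw [Pi.smul_apply, Matrix.cramer_apply, dressingCoord, smul_eq_mul, div_eq_inv_mul]
  rw [e, Matrix.mulVec_smul, h, smul_smul, inv_mul_cancel₀ hdet, one_smul]

theorem evalAt_dressing (hdet : (wronskianMat A Φ N).det ≠ 0) :
    evalAt A Φ N (dressing A Φ) = 0 := by
  rw [evalAt_eq_sum_range, Finset.sum_range_succ, Nat.sub_self, coeff_zero_dressing,
    Matrix.mul_one, Finset.sum_range]
  ext i b
  have h := congrFun (wronskianMat_mulVec_dressingCoord hdet b) i
  rw [wronskianMat_mulVec] at h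
  rw [Matrix.add_apply, ← h, Matrix.sum_apply, ← Finset.sum_add_distrib, Matrix.zero_apply]
  refine Finset.sum_eq_zero fun k _ => ?_
  rw [Matrix.mul_apply, ← Finset.sum_add_distrib]
  refine Finset.sum_eq_zero fun c _ => ?_
  rw [coeff_dressing]
  ring

end

section
variable {M : ℕ} {A : Matrix (Fin (2 * (M + 1))) (Fin (2 * (M + 1))) ℂ}
  {Φ : Matrix (Fin (2 * (M + 1))) (Fin 2) ℂ}

/-- This is the uniqueness principle behind `dressing_flow`: where `f ≠ 0`, no nonzero polynomial of
degree less than `N` annihilates `Φ`. -/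
theorem evalAt_injective (hdet : (wronskianMat A Φ (M + 1)).det ≠ 0) (p : PowerSeries Mat2)
    (hp : evalAt A Φ M p = 0) : ∀ k ≤ M, PowerSeries.coeff k p = 0 := by
  intro k hk
  rw [evalAt_eq_sum_range] at hp
  have := (det_wronskianMat_ne_zero_iff A Φ).mp hdet (fun k => PowerSeries.coeff (M - k) p) hp
    (M - k) (by omega)
  simpa only [Nat.sub_sub_self hk] using this

theorem coeff_one_dressing (a b : Fin 2) : PowerSeries.coeff 1 (dressing A Φ) a b =
    -(halfSign a ^ M * dressingCoord A Φ b (finProdFinEquiv (a, Fin.last M))) := by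
  have := coeff_dressing A Φ (Fin.last M) a b
  simpa using this

/-- Moving the column `φ^(N)` to the end by a cycle of sign `(-1)^M` produces the Cramer numerator
in which the last `ψ` column of `f` is replaced. The factor 2 absorbs the surplus `1/2` in `φ^(N) =
(1/2)ᴺ Aᴺ φ`. -/
theorem det_wronskianMat_succ (hdet : (wronskianMat A Φ (M + 1)).det ≠ 0) :
    2 * (wronskianMat A Φ (M + 1 + 1)).det =
      -(PowerSeries.coeff 1 (dressing A Φ) 1 0) * (wronskianMat A Φ (M + 1)).det := by
  set i₀ : Fin (2 * (M + 1)) := ⟨M + 1, by omega⟩ with hi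
  set j₀ : Fin (2 * (M + 1)) := ⟨2 * M + 1, by omega⟩ with hj
  have hij : i₀ ≤ j₀ := by rw [Fin.le_def]; simp only [hi, hj]; omega
  have hlast : finProdFinEquiv (1, Fin.last M) = j₀ := by
    ext; simp [finProdFinEquiv, hj]; omega
  have e : (wronskianMat A Φ (M + 1 + 1)).submatrix id (Fin.cycleIcc i₀ j₀) =
      (wronskianMat A Φ (M + 1)).updateCol j₀
        (halfSign 0 ^ (M + 1) • fun i => (A ^ (M + 1) * Φ) i 0) := by
    ext i j
    rw [Matrix.submatrix_apply, id]
    rcases lt_or_ge j i₀ with h | h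
    · rw [Fin.cycleIcc_of_lt h, Matrix.updateCol_ne (h.trans_le hij).ne]
      rw [Fin.lt_def] at h
      simp only [hi] at h
      simp only [wronskianMat, Matrix.of_apply]
      rw [if_pos (by omega), if_pos (by omega)]
    · rcases lt_or_ge j j₀ with h' | h'
      · rw [Fin.cycleIcc_of_ge_of_lt h h', Matrix.updateCol_ne h'.ne]
        have hv : ((j + 1 : Fin (2 * (M + 1))) : ℕ) = j + 1 := by
          rw [Fin.lt_def] at h'
          simp only [hj] at h'
          rw [Fin.val_add, Fin.val_one']
          rw [Nat.mod_eq_of_lt (a := 1) (by omega)]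
          exact Nat.mod_eq_of_lt (by omega)
        rw [Fin.le_def] at h
        simp only [hi] at h
        simp only [wronskianMat, Matrix.of_apply, hv]
        rw [if_neg (by omega), if_neg (by omega), Nat.add_sub_add_right]
      · obtain rfl : j = j₀ := le_antisymm (by
          rw [Fin.le_def]; simp only [hj]; omega) h'
        rw [Fin.cycleIcc_of_last hij, Matrix.updateCol_self]
        simp [wronskianMat, hi]
  have hs := Matrix.det_permute' (Fin.cycleIcc i₀ j₀) (wronskianMat A Φ (M + 1 + 1))
  rw [e, Matrix.det_updateCol_smul, Fin.sign_cycleIcc_of_le hij] at hs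
  rw [coeff_one_dressing, dressingCoord, hlast, neg_neg, mul_assoc, div_mul_cancel₀ _ hdet]
  have hn : (j₀ - i₀ : ℕ) = M := by simp only [hi, hj]; omega
  rw [hn] at hs
  have h1 : ((((-1 : ℤˣ) ^ M : ℤˣ) : ℤ) : ℂ) = (-1) ^ M := by push_cast; rfl
  rw [h1] at hs
  have h2 : halfSign 1 ^ M = (-1) ^ M * halfSign 0 ^ M := by
    rw [← mul_pow]; simp [halfSign]
  have h3 : halfSign 0 = 1 / 2 := rfl
  have h4 : ((-1 : ℂ) ^ M) * (-1) ^ M = 1 := by rw [← mul_pow]; simp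
  rw [pow_succ] at hs
  rw [h2]
  generalize (((wronskianMat A Φ (M + 1)).updateCol j₀ fun i => (A ^ (M + 1) * Φ) i 0).det) = d at *
  rw [h3] at *
  linear_combination (-2 * (wronskianMat A Φ (M + 1 + 1)).det) * h4 - 2 * (-1) ^ M * hs

/-- The Cramer numerator here replaces the last `φ` column of `f` by `ψ^(N)`. Cycling that column to
the end has sign `(-1)^{M+1}`, which cancels the sign in `ψ^(N) = (-1/2)ᴺ Aᴺ ψ`. -/
theorem det_wronskianMat_pred (hdet : (wronskianMat A Φ (M + 1)).det ≠ 0) :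
    2 * (wronskianMat A Φ M).det =
      -(PowerSeries.coeff 1 (dressing A Φ) 0 1) * (wronskianMat A Φ (M + 1)).det := by
  set i₀ : Fin (2 * (M + 1)) := ⟨M, by omega⟩ with hi
  set j₀ : Fin (2 * (M + 1)) := ⟨2 * M + 1, by omega⟩ with hj
  have hij : i₀ ≤ j₀ := by rw [Fin.le_def]; simp only [hi, hj]; omega
  have hlast : finProdFinEquiv (0, Fin.last M) = i₀ := by
    ext; simp [finProdFinEquiv, hi]
  have e : ((wronskianMat A Φ (M + 1)).updateCol i₀
        (halfSign 1 ^ (M + 1) • fun i => (A ^ (M + 1) * Φ) i 1)).submatrix id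
          (Fin.cycleIcc i₀ j₀) = wronskianMat A Φ M := by
    ext i j
    rw [Matrix.submatrix_apply, id]
    rcases lt_or_ge j i₀ with h | h
    · rw [Fin.cycleIcc_of_lt h, Matrix.updateCol_ne h.ne]
      rw [Fin.lt_def] at h
      simp only [hi] at h
      simp only [wronskianMat, Matrix.of_apply]
      rw [if_pos (by omega), if_pos (by omega)]
    · rcases lt_or_ge j j₀ with h' | h'
      · have hv : ((j + 1 : Fin (2 * (M + 1))) : ℕ) = j + 1 := by
          rw [Fin.lt_def] at h'
          simp only [hj] at h'
          rw [Fin.val_add, Fin.val_one']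
          rw [Nat.mod_eq_of_lt (a := 1) (by omega)]
          exact Nat.mod_eq_of_lt (by omega)
        rw [Fin.le_def] at h
        simp only [hi] at h
        rw [Fin.cycleIcc_of_ge_of_lt (by rwa [Fin.le_def]) h', Matrix.updateCol_ne (by
          intro h''
          rw [Fin.ext_iff, hv] at h''
          simp only [hi] at h''
          omega)]
        simp only [wronskianMat, Matrix.of_apply, hv]
        rw [if_neg (by omega), if_neg (by omega), Nat.add_sub_add_right]
      · obtain rfl : j = j₀ := le_antisymm (by
          rw [Fin.le_def]; simp only [hj]; omega) h'
        rw [Fin.cycleIcc_of_last hij, Matrix.updateCol_self]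
        simp only [wronskianMat, Matrix.of_apply, hj, Pi.smul_apply, smul_eq_mul]
        rw [if_neg (by omega), show 2 * M + 1 - M = M + 1 by omega]
  have hs := Matrix.det_permute' (Fin.cycleIcc i₀ j₀) ((wronskianMat A Φ (M + 1)).updateCol i₀
        (halfSign 1 ^ (M + 1) • fun i => (A ^ (M + 1) * Φ) i 1))
  rw [e, Matrix.det_updateCol_smul, Fin.sign_cycleIcc_of_le hij] at hs
  rw [coeff_one_dressing, dressingCoord, hlast, neg_neg, mul_assoc, div_mul_cancel₀ _ hdet]
  have hn : (j₀ - i₀ : ℕ) = M + 1 := by simp only [hi, hj]; omega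
  rw [hn] at hs
  have h1 : ((((-1 : ℤˣ) ^ (M + 1) : ℤˣ) : ℤ) : ℂ) = (-1) ^ (M + 1) := by push_cast; rfl
  have h2 : (-1 : ℂ) ^ (M + 1) * halfSign 1 ^ (M + 1) = halfSign 0 ^ (M + 1) := by
    rw [← mul_pow]; simp [halfSign]
  rw [h1, ← mul_assoc, h2, pow_succ] at hs
  rw [hs]
  simp only [halfSign, Matrix.cons_val_zero]
  ring

end

/-! Smoothness. -/

section
variable {E : Type*} [NormedAddCommGroup E] [NormedSpace ℝ E]

theorem contDiffAt_det {n : Type*} [Fintype n] [DecidableEq n] {F : E → Matrix n n ℂ} {p : E}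
    (hF : ∀ i j, ContDiffAt ℝ ∞ (fun y => F y i j) p) :
    ContDiffAt ℝ ∞ (fun y => (F y).det) p := by
  simp only [Matrix.det_apply]
  exact ContDiffAt.sum fun σ _ => ContDiffAt.const_smul _ (contDiffAt_prod fun i _ => hF _ _)

variable {N : ℕ} {A : Matrix (Fin (2 * N)) (Fin (2 * N)) ℂ}
  {Φ : E → Matrix (Fin (2 * N)) (Fin 2) ℂ} {p : E}

theorem contDiffAt_mul_apply (B : Matrix (Fin (2 * N)) (Fin (2 * N)) ℂ)
    (hΦ : ∀ i c, ContDiffAt ℝ ∞ (fun y => Φ y i c) p) (i : Fin (2 * N)) (c : Fin 2) :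
    ContDiffAt ℝ ∞ (fun y => (B * Φ y) i c) p := by
  simp only [Matrix.mul_apply]
  exact ContDiffAt.sum fun k _ => contDiffAt_const.mul (hΦ k c)

theorem contDiffAt_wronskianMat (hΦ : ∀ i c, ContDiffAt ℝ ∞ (fun y => Φ y i c) p) (a : ℕ)
    (i j : Fin (2 * N)) : ContDiffAt ℝ ∞ (fun y => wronskianMat A (Φ y) a i j) p := by
  simp only [wronskianMat, Matrix.of_apply]
  split_ifs
  · exact contDiffAt_const.mul (contDiffAt_mul_apply _ hΦ _ _)
  · exact contDiffAt_const.mul (contDiffAt_mul_apply _ hΦ _ _)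

/-- Cramer's formula presents each nonconstant coefficient as a quotient of determinants, so
smoothness follows wherever the denominator is nonzero, for any parameter space `E`. -/
theorem contDiffAt_dressing (hΦ : ∀ i c, ContDiffAt ℝ ∞ (fun y => Φ y i c) p)
    (hdet : (wronskianMat A (Φ p) N).det ≠ 0) (k : ℕ) (a b : Fin 2) :
    ContDiffAt ℝ ∞ (fun y => PowerSeries.coeff k (dressing A (Φ y)) a b) p := by
  rcases Nat.eq_zero_or_pos k with rfl | hk
  · simp only [coeff_zero_dressing]
    exact contDiffAt_const
  rcases Nat.lt_or_ge N k with h | h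
  · simp only [coeff_dressing_of_lt _ _ h]
    exact contDiffAt_const
  · obtain ⟨j, rfl⟩ : ∃ j : Fin N, k = N - j := ⟨⟨N - k, by omega⟩, by simp; omega⟩
    simp only [coeff_dressing, dressingCoord, div_eq_mul_inv]
    refine (contDiffAt_const.mul (ContDiffAt.mul (contDiffAt_det fun i l => ?_)
      (ContDiffAt.inv (contDiffAt_det (contDiffAt_wronskianMat hΦ N)) hdet))).neg
    simp only [Matrix.updateCol_apply]
    split_ifs
    · exact contDiffAt_mul_apply _ hΦ _ _
    · exact contDiffAt_wronskianMat hΦ N _ _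

end

/-! The flows of the dressing polynomial. -/

section
variable {M : ℕ} {A : Matrix (Fin (2 * (M + 1))) (Fin (2 * (M + 1))) ℂ}
  {Φ : ℝ → Matrix (Fin (2 * (M + 1))) (Fin 2) ℂ}

theorem hasCoeffDerivAt_dressing {x : ℝ} {n : ℕ} {c : ℂ}
    (hs : ∀ i c, ContDiffAt ℝ ∞ (fun y => Φ y i c) x)
    (hdet : (wronskianMat A (Φ x) (M + 1)).det ≠ 0)
    (hΦ : HasEntryDerivAt Φ (c • (A ^ n * Φ x * sigmaThree)) x) :
    HasCoeffDerivAt (fun y => dressing A (Φ y)) (-(PowerSeries.C (c • (1 : Mat2)) *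
      (PowerSeries.X * (dressing A (Φ x) * shift (n + 1) (resolvent (dressing A (Φ x))))))) x := by
  -- Smoothness provides some derivative `m'`; `dressing_flow` then identifies it.
  set m' : PowerSeries Mat2 := PowerSeries.mk fun k => Matrix.of fun a b =>
    deriv (fun y => PowerSeries.coeff k (dressing A (Φ y)) a b) x with hm'
  have hm : HasCoeffDerivAt (fun y => dressing A (Φ y)) m' x := by
    intro k a b
    rw [hm', PowerSeries.coeff_mk, Matrix.of_apply]
    exact ((contDiffAt_dressing hs hdet k a b).differentiableAt (by simp)).hasDerivAt
  rw [← dressing_flow (constantCoeff_dressing A _) (fun k hk => coeff_dressing_of_lt A _ hk)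
    (by ext a b; simp [hm', coeff_zero_dressing])
    (fun k hk => by ext a b; simp [hm', coeff_dressing_of_lt _ _ hk]) ?_
    (evalAt_injective hdet) hΦ hm]
  · exact hm
  · have hc := (contDiffAt_det (contDiffAt_wronskianMat (A := A) hs (M + 1))).continuousAt
    exact (hc.eventually_ne hdet).mono fun y hy => evalAt_dressing hy

/-- At order `λ⁻¹` only the constant coefficient 1 of `m` meets the tail of `R`, whose first
coefficient is `R_{n+1}`. -/
theorem hasDerivAt_coeff_one_dressing {x : ℝ} {n : ℕ} {c : ℂ}
    (hs : ∀ i c, ContDiffAt ℝ ∞ (fun y => Φ y i c) x)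
    (hdet : (wronskianMat A (Φ x) (M + 1)).det ≠ 0)
    (hΦ : HasEntryDerivAt Φ (c • (A ^ n * Φ x * sigmaThree)) x) (a b : Fin 2) :
    HasDerivAt (fun y => PowerSeries.coeff 1 (dressing A (Φ y)) a b)
      (-(c * PowerSeries.coeff (n + 1) (resolvent (dressing A (Φ x))) a b)) x := by
  have h := hasCoeffDerivAt_dressing hs hdet hΦ 1 a b
  rw [map_neg, PowerSeries.coeff_C_mul, PowerSeries.coeff_succ_X_mul 0, PowerSeries.coeff_mul] at h
  simpa [constantCoeff_dressing, shift, Matrix.smul_mul] using h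

/-- The off-diagonal coefficients of the resolvent of the dressing polynomial are the AKNS flows
in the off-diagonal entries of its leading coefficient. -/
theorem coeff_resolvent_dressing (hs : ∀ x i c, ContDiffAt ℝ ∞ (fun y => Φ y i c) x)
    (hΦ : ∀ x, HasEntryDerivAt Φ ((1 / 2 : ℂ) • (A ^ 1 * Φ x * sigmaThree)) x) {x : ℝ}
    (hdet : (wronskianMat A (Φ x) (M + 1)).det ≠ 0) (n : ℕ) :
    PowerSeries.coeff (n + 1) (resolvent (dressing A (Φ x))) 0 1 =
      2 * evalJet (fun y => -PowerSeries.coeff 1 (dressing A (Φ y)) 0 1)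
        (fun y => PowerSeries.coeff 1 (dressing A (Φ y)) 1 0) x (K n).1 := by
  have hS : IsOpen {y | (wronskianMat A (Φ y) (M + 1)).det ≠ 0} :=
    isOpen_ne_fun (continuous_iff_continuousAt.mpr fun y =>
      (contDiffAt_det (contDiffAt_wronskianMat (hs y) (M + 1))).continuousAt) continuous_const
  refine (resolvent_eq_flow (q := fun y => -PowerSeries.coeff 1 (dressing A (Φ y)) 0 1)
    (r := fun y => PowerSeries.coeff 1 (dressing A (Φ y)) 1 0) hS
    (fun y hy => (contDiffAt_dressing (hs y) hy 1 0 1).neg)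
    (fun y hy => contDiffAt_dressing (hs y) hy 1 1 0)
    (fun y k => PowerSeries.coeff k (resolvent (dressing A (Φ y))))
    (fun y _ => coeff_zero_resolvent (constantCoeff_dressing A _)) ?_ ?_ ?_
    (fun y _ k => trace_coeff_resolvent (constantCoeff_dressing A _) k)
    (fun y hy k => hasCoeffDerivAt_resolvent (m := fun y => dressing A (Φ y))
      (fun y => constantCoeff_dressing A _) (hasCoeffDerivAt_dressing (hs y) hy (hΦ y)) rfl k)
    n x hdet).1
  · intro y _
    rw [coeff_one_resolvent (constantCoeff_dressing A _)]
    simp [Matrix.mul_apply, Fin.sum_univ_two]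
    ring
  · intro y _
    rw [coeff_one_resolvent (constantCoeff_dressing A _)]
    simp [Matrix.mul_apply, Fin.sum_univ_two]
    ring
  · intro y _ k
    rw [← PowerSeries.coeff_mul, resolvent_mul_self (constantCoeff_dressing A _),
      PowerSeries.coeff_one, if_neg (Nat.succ_ne_zero k)]

end

/-! Exponentials of affine functions. -/

section
variable {𝔸 : Type*} [NormedRing 𝔸] [NormedAlgebra ℝ 𝔸] [CompleteSpace 𝔸]

/-- The functional `L` reads off a coordinate, so the later statements on matrices need not mention
a norm. -/
theorem contDiff_exp_affine (L : 𝔸 →L[ℝ] ℂ) (B D E : 𝔸) :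
    ContDiff ℝ ∞ fun p : ℝ × ℝ => L (NormedSpace.exp (p.1 • B + p.2 • D + E)) := by
  have h : ContDiff ℝ ∞ fun p : ℝ × ℝ => p.1 • B + p.2 • D + E := by fun_prop
  have he : ContDiff ℝ ∞ (NormedSpace.exp : 𝔸 → 𝔸) :=
    contDiff_iff_contDiffAt.mpr fun x => (NormedSpace.exp_analytic (𝕂 := ℝ) x).contDiffAt
  exact L.contDiff.comp (he.comp h)

theorem hasDerivAt_exp_affine (L : 𝔸 →L[ℝ] ℂ) {B D : 𝔸} (h : Commute B D) (x : ℝ) :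
    HasDerivAt (fun y : ℝ => L (NormedSpace.exp (y • B + D)))
      (L (B * NormedSpace.exp (x • B + D))) x := by
  have hc : ∀ y : ℝ, Commute (y • B) D := fun y => h.smul_left y
  let _ : NormedAlgebra ℚ 𝔸 := NormedAlgebra.restrictScalars ℚ ℝ 𝔸
  simp only [fun y => NormedSpace.exp_add_of_commute (hc y), ← mul_assoc]
  exact L.hasFDerivAt.comp_hasDerivAt x ((hasDerivAt_exp_smul_const' B x).mul_const _)

end

section
variable {n : ℕ}

/-- A coordinate of `F v`, as a linear function of the matrix `F`. -/
def mulVecCoord (v : Fin n → ℂ) (i : Fin n) : Matrix (Fin n) (Fin n) ℂ →ₗ[ℝ] ℂ where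
  toFun F := (F *ᵥ v) i
  map_add' F G := by rw [Matrix.add_mulVec, Pi.add_apply]
  map_smul' c F := by rw [Matrix.smul_mulVec, Pi.smul_apply]; rfl

open scoped Matrix.Norms.Operator in
theorem contDiff_exp_affine_mulVec (B D E : Matrix (Fin n) (Fin n) ℂ) (v : Fin n → ℂ)
    (i : Fin n) : ContDiff ℝ ∞ fun p : ℝ × ℝ =>
      (NormedSpace.exp (p.1 • B + p.2 • D + E) *ᵥ v) i :=
  contDiff_exp_affine (LinearMap.toContinuousLinearMap (mulVecCoord v i)) B D E

open scoped Matrix.Norms.Operator in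
theorem hasDerivAt_exp_affine_mulVec {B D : Matrix (Fin n) (Fin n) ℂ} (h : Commute B D)
    (v : Fin n → ℂ) (i : Fin n) (x : ℝ) :
    HasDerivAt (fun y : ℝ => (NormedSpace.exp (y • B + D) *ᵥ v) i)
      ((B *ᵥ (NormedSpace.exp (x • B + D) *ᵥ v)) i) x := by
  have := hasDerivAt_exp_affine (LinearMap.toContinuousLinearMap (mulVecCoord v i)) h x
  rw [Matrix.mulVec_mulVec]
  exact this

variable {A : Matrix (Fin n) (Fin n) ℂ} {t : Times}

theorem hasSum_update (ht : Admissible A t) (l : ℕ+) (s : ℝ) :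
    HasSum (fun j : ℕ+ => ((Function.update t l s j : ℝ) : ℂ) • A ^ (2 * (j : ℕ)))
      ((s - t l) • A ^ (2 * (l : ℕ)) + ∑' j : ℕ+, (t j : ℂ) • A ^ (2 * (j : ℕ))) := by
  have h := (Summable.hasSum ht).update l ((s : ℂ) • A ^ (2 * (l : ℕ)))
  have e : (fun j : ℕ+ => ((Function.update t l s j : ℝ) : ℂ) • A ^ (2 * (j : ℕ))) =
      Function.update (fun j : ℕ+ => (t j : ℂ) • A ^ (2 * (j : ℕ))) l
        ((s : ℂ) • A ^ (2 * (l : ℕ))) := by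
    ext1 j
    by_cases hj : j = l
    · subst hj; simp
    · simp [hj]
  rw [e]
  rwa [← sub_smul, ← Complex.ofReal_sub, Complex.coe_smul] at h

theorem Admissible.update (ht : Admissible A t) (l : ℕ+) (s : ℝ) :
    Admissible A (Function.update t l s) := (hasSum_update ht l s).summable

/-- The part of the phase that depends neither on `x` nor on `t_{2l}`. -/
def restPhase (A : Matrix (Fin n) (Fin n) ℂ) (t : Times) (l : ℕ+) : Matrix (Fin n) (Fin n) ℂ :=
  (Complex.I / 2) • (∑' j : ℕ+, (t j : ℂ) • A ^ (2 * (j : ℕ)) - t l • A ^ (2 * (l : ℕ)))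

theorem phase_update (ht : Admissible A t) (l : ℕ+) (x s : ℝ) :
    phase A x (Function.update t l s) = x • ((1 / 2 : ℂ) • A)
      + s • ((Complex.I / 2) • A ^ (2 * (l : ℕ))) + restPhase A t l := by
  rw [phase, (hasSum_update ht l s).tsum_eq, restPhase]
  ext i j
  simp only [Matrix.add_apply, Matrix.sub_apply, Matrix.smul_apply, smul_eq_mul,
    Complex.real_smul]
  push_cast
  ring

theorem commute_tsum (A : Matrix (Fin n) (Fin n) ℂ) (t : Times) :
    Commute A (∑' j : ℕ+, (t j : ℂ) • A ^ (2 * (j : ℕ))) :=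
  Commute.tsum_right A fun _ => ((Commute.refl A).pow_right _).smul_right _

theorem commute_restPhase (A : Matrix (Fin n) (Fin n) ℂ) (t : Times) (l : ℕ+) :
    Commute A (restPhase A t l) :=
  ((commute_tsum A t).sub_right (((Commute.refl A).pow_right _).smul_right _)).smul_right _

/-- The `n × 2` matrix with columns `φ`, `ψ`. -/
def solutionMat (A : Matrix (Fin n) (Fin n) ℂ) (Cp Cm : Fin n → ℂ) (x : ℝ) (t : Times) :
    Matrix (Fin n) (Fin 2) ℂ :=
  Matrix.of fun i c => ![phi A Cp x t i, psi A Cm x t i] c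

variable (Cp Cm : Fin n → ℂ)

theorem contDiff_solutionMat (ht : Admissible A t) (l : ℕ+) (i : Fin n) (c : Fin 2) :
    ContDiff ℝ ∞ fun p : ℝ × ℝ =>
      solutionMat A Cp Cm p.1 (Function.update t l p.2) i c := by
  fin_cases c
  · simp only [solutionMat, phi, phase_update ht]
    exact contDiff_exp_affine_mulVec _ _ _ Cp i
  · have h := contDiff_exp_affine_mulVec (-((1 / 2 : ℂ) • A))
      (-((Complex.I / 2) • A ^ (2 * (l : ℕ)))) (-restPhase A t l) Cm i
    simp only [smul_neg, ← neg_add] at h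
    simp only [← phase_update ht] at h
    exact h

theorem hasEntryDerivAt_solutionMat (x : ℝ) :
    HasEntryDerivAt (fun y => solutionMat A Cp Cm y t)
      ((1 / 2 : ℂ) • (A ^ 1 * solutionMat A Cp Cm x t * sigmaThree)) x := by
  set D := (Complex.I / 2) • ∑' j : ℕ+, (t j : ℂ) • A ^ (2 * (j : ℕ)) with hD
  have hp : ∀ y : ℝ, phase A y t = y • ((1 / 2 : ℂ) • A) + D := by
    intro y
    rw [phase, ← hD]
    congr 1
    ext i j
    simp only [Matrix.smul_apply, smul_eq_mul, Complex.real_smul]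
    ring
  have hc : Commute ((1 / 2 : ℂ) • A) D := ((commute_tsum A t).smul_right _).smul_left _
  intro i c
  fin_cases c
  · have h := hasDerivAt_exp_affine_mulVec hc Cp i x
    simp only [← hp] at h
    refine h.congr_deriv ?_
    simp [Matrix.mul_apply, Fin.sum_univ_two, solutionMat, phi, Matrix.mulVec, dotProduct,
      Matrix.smul_apply, mul_assoc, Finset.mul_sum]
  · have h := hasDerivAt_exp_affine_mulVec hc.neg_left.neg_right Cm i x
    simp only [smul_neg, ← neg_add, ← hp] at h
    refine h.congr_deriv ?_
    simp [Matrix.mul_apply, Fin.sum_univ_two, solutionMat, psi, Matrix.mulVec, dotProduct,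
      Matrix.smul_apply, mul_assoc, Finset.mul_sum]

theorem hasEntryDerivAt_solutionMat_time (ht : Admissible A t) (l : ℕ+) (x : ℝ) :
    HasEntryDerivAt (fun s => solutionMat A Cp Cm x (Function.update t l s))
      ((Complex.I / 2) • (A ^ (2 * (l : ℕ)) * solutionMat A Cp Cm x t * sigmaThree)) (t l) := by
  set D := x • ((1 / 2 : ℂ) • A) + restPhase A t l with hD
  have hp : ∀ s : ℝ, phase A x (Function.update t l s) =
      s • ((Complex.I / 2) • A ^ (2 * (l : ℕ))) + D := by
    intro s
    rw [phase_update ht, hD]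
    abel
  have hp' : phase A x t = t l • ((Complex.I / 2) • A ^ (2 * (l : ℕ))) + D := by
    rw [← hp, Function.update_eq_self]
  have hc : Commute ((Complex.I / 2) • A ^ (2 * (l : ℕ))) D :=
    ((((((Commute.refl A).smul_right (1 / 2 : ℂ)).smul_right x).add_right
      (commute_restPhase A t l)).pow_left _).smul_left _)
  intro i c
  fin_cases c
  · have h := hasDerivAt_exp_affine_mulVec hc Cp i (t l)
    rw [← hp'] at h
    simp only [← hp] at h
    refine h.congr_deriv ?_
    simp [Matrix.mul_apply, Fin.sum_univ_two, solutionMat, phi, Matrix.mulVec, dotProduct,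
      Matrix.smul_apply, mul_assoc, Finset.mul_sum]
  · have h := hasDerivAt_exp_affine_mulVec hc.neg_left.neg_right Cm i (t l)
    simp only [smul_neg, ← neg_add] at h
    rw [← hp'] at h
    simp only [← hp] at h
    refine h.congr_deriv ?_
    simp [Matrix.mul_apply, Fin.sum_univ_two, solutionMat, psi, Matrix.mulVec, dotProduct,
      Matrix.smul_apply, mul_assoc, Finset.mul_sum]

theorem iteratedDeriv_solutionMat (i : Fin n) (c : Fin 2) (k : ℕ) :
    iteratedDeriv k (fun y => solutionMat A Cp Cm y t i c) =
      fun x => halfSign c ^ k * (A ^ k * solutionMat A Cp Cm x t) i c := by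
  induction k with
  | zero => simp
  | succ k ih =>
    rw [iteratedDeriv_succ, ih]
    funext x
    have h := (((hasEntryDerivAt_const (A ^ k) x).mul (hasEntryDerivAt_solutionMat (A := A) (t := t)
      Cp Cm x)) i
      c).const_mul (halfSign c ^ k)
    rw [h.deriv, Matrix.zero_mul, zero_add, Matrix.mul_smul, ← Matrix.mul_assoc,
      ← Matrix.mul_assoc, pow_one, ← pow_succ, pow_succ (halfSign c)]
    fin_cases c <;> simp [Matrix.mul_apply, Fin.sum_univ_two, halfSign] <;> ring

theorem doubleWronskian_eq (a : ℕ) (x : ℝ) :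
    doubleWronskian (fun y => phi A Cp y t) (fun y => psi A Cm y t) a x =
      (wronskianMat A (solutionMat A Cp Cm x t) a).det := by
  unfold doubleWronskian wronskianMat
  congr 2
  funext i j
  have h0 := congrFun (iteratedDeriv_solutionMat (A := A) (t := t) Cp Cm i 0 j) x
  have h1 := congrFun (iteratedDeriv_solutionMat (A := A) (t := t) Cp Cm i 1 (j - a)) x
  rw [← h0, ← h1]
  rfl

end

/-! ### The functions `f`, `q`, `r` and the unreduced even flows -/

section
variable {M : ℕ} {A : Matrix (Fin (2 * (M + 1))) (Fin (2 * (M + 1))) ℂ} {t : Times}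
  (Cp Cm : Fin (2 * (M + 1)) → ℂ)

theorem tauF_eq (x : ℝ) :
    tauF A Cp Cm x t = (wronskianMat A (solutionMat A Cp Cm x t) (M + 1)).det :=
  doubleWronskian_eq Cp Cm _ x

variable {Cp Cm}

theorem qSol_eq {x : ℝ} (hf : tauF A Cp Cm x t ≠ 0) :
    qSol A Cp Cm x t =
      -PowerSeries.coeff 1 (dressing A (solutionMat A Cp Cm x t)) 0 1 := by
  rw [qSol, div_eq_iff hf, tauH, doubleWronskian_eq, Nat.add_sub_cancel,
    det_wronskianMat_pred (by rwa [← tauF_eq Cp Cm]), tauF_eq]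

theorem rSol_eq {x : ℝ} (hf : tauF A Cp Cm x t ≠ 0) :
    rSol A Cp Cm x t =
      PowerSeries.coeff 1 (dressing A (solutionMat A Cp Cm x t)) 1 0 := by
  rw [rSol, div_eq_iff hf, tauG, doubleWronskian_eq,
    det_wronskianMat_succ (by rwa [← tauF_eq Cp Cm]), tauF_eq]
  ring

theorem eventually_tauF_ne_zero (ht : Admissible A t) (l : ℕ+) {x : ℝ}
    (hf : tauF A Cp Cm x t ≠ 0) :
    ∀ᶠ p : ℝ × ℝ in nhds (x, t l), tauF A Cp Cm p.1 (Function.update t l p.2) ≠ 0 := by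
  simp only [tauF_eq]
  refine ContinuousAt.eventually_ne (contDiffAt_det (contDiffAt_wronskianMat
    (fun i c => (contDiff_solutionMat Cp Cm ht l i c).contDiffAt) _)).continuousAt ?_
  simpa only [Function.update_eq_self, ← tauF_eq Cp Cm] using hf

theorem contDiffAt_qSol (ht : Admissible A t) (l : ℕ+) {x : ℝ}
    (hf : tauF A Cp Cm x t ≠ 0) :
    ContDiffAt ℝ ∞ (fun p : ℝ × ℝ => qSol A Cp Cm p.1 (Function.update t l p.2)) (x, t l) := by
  refine ContDiffAt.congr_of_eventuallyEq (contDiffAt_dressing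
    (fun i c => (contDiff_solutionMat Cp Cm ht l i c).contDiffAt) ?_ 1 0 1).neg
    ((eventually_tauF_ne_zero ht l hf).mono fun p hp => qSol_eq hp)
  simpa only [Function.update_eq_self, ← tauF_eq Cp Cm] using hf

/-- The double Wronskian solution of the even flows of the AKNS hierarchy. -/
theorem qSol_flow (ht : Admissible A t) (l : ℕ+) {x : ℝ} (hf : tauF A Cp Cm x t ≠ 0) :
    Complex.I * deriv (fun s : ℝ => qSol A Cp Cm x (Function.update t l s)) (t l) =
      -evalJet (fun y => qSol A Cp Cm y t) (fun y => rSol A Cp Cm y t) x (K (2 * (l : ℕ))).1 := by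
  have hsx : ∀ y i c, ContDiffAt ℝ ∞ (fun y => solutionMat A Cp Cm y t i c) y := by
    intro y i c
    have := ((contDiff_solutionMat Cp Cm ht l i c).comp
      (contDiff_id.prodMk (contDiff_const (c := t l)))).contDiffAt (x := y)
    simpa only [Function.comp_def, Function.update_eq_self, id] using this
  have hst : ∀ i c, ContDiffAt ℝ ∞
      (fun s => solutionMat A Cp Cm x (Function.update t l s) i c) (t l) := fun i c =>
    ((contDiff_solutionMat Cp Cm ht l i c).comp
      ((contDiff_const (c := x)).prodMk contDiff_id)).contDiffAt
  have hdet : (wronskianMat A (solutionMat A Cp Cm x t) (M + 1)).det ≠ 0 := by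
    rwa [← tauF_eq Cp Cm]
  have ev := eventually_tauF_ne_zero ht l hf
  have evt : ∀ᶠ s in nhds (t l), tauF A Cp Cm x (Function.update t l s) ≠ 0 :=
    (Continuous.prodMk_right x).continuousAt.eventually ev
  have evx : ∀ᶠ y in nhds x, tauF A Cp Cm y t ≠ 0 := by
    have := ((Continuous.prodMk_left (t l)).continuousAt (x := x)).eventually ev
    simpa only [Function.update_eq_self] using this
  -- With `n = 2l` and `c = i/2`, the relation `(R_{2l+1})₀₁ = 2 K₁,₂ₗ` gives `q_{t_{2l}} = i
  -- K₁,₂ₗ`.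
  have hd := hasDerivAt_coeff_one_dressing (A := A) (n := 2 * (l : ℕ)) (c := Complex.I / 2) hst
    (by rwa [Function.update_eq_self])
    (by rw [Function.update_eq_self]; exact hasEntryDerivAt_solutionMat_time Cp Cm ht l x) 0 1
  rw [Function.update_eq_self, coeff_resolvent_dressing hsx
    (fun y => hasEntryDerivAt_solutionMat Cp Cm y) hdet] at hd
  have hd' := hd.fun_neg.congr_of_eventuallyEq (f₁ := fun s => qSol A Cp Cm x (Function.update t l s))
    (evt.mono fun s hs => qSol_eq hs)
  rw [hd'.deriv, evalJet_congr (evx.mono fun y hy => qSol_eq hy)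
    (evx.mono fun y hy => rSol_eq hy)]
  linear_combination (evalJet (fun y => -PowerSeries.coeff 1
    (dressing A (solutionMat A Cp Cm y t)) 0 1) (fun y => PowerSeries.coeff 1
    (dressing A (solutionMat A Cp Cm y t)) 1 0) x (K (2 * (l : ℕ))).1) * Complex.I_sq

end

/-! The reduction `r(x) = δ q*(σ x)`. -/

theorem map_conj_eq {m n : Type*} (B : Matrix m n ℂ) : B.map (starRingEnd ℂ) = Bᴴᵀ := rfl

theorem continuous_map_conj {m n : Type*} :
    Continuous fun B : Matrix m n ℂ => B.map (starRingEnd ℂ) :=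
  continuous_id.matrix_map Complex.continuous_conj

theorem map_conj_exp {n : ℕ} (B : Matrix (Fin n) (Fin n) ℂ) :
    (NormedSpace.exp B).map (starRingEnd ℂ) = NormedSpace.exp (B.map (starRingEnd ℂ)) := by
  rw [map_conj_eq, map_conj_eq, ← Matrix.exp_conjTranspose, ← Matrix.exp_transpose]

theorem map_conj_mul {l m n : Type*} [Fintype m] (B : Matrix l m ℂ) (C : Matrix m n ℂ) :
    (B * C).map (starRingEnd ℂ) = B.map (starRingEnd ℂ) * C.map (starRingEnd ℂ) :=
  Matrix.map_mul

theorem map_conj_map_conj {m n : Type*} (B : Matrix m n ℂ) :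
    (B.map (starRingEnd ℂ)).map (starRingEnd ℂ) = B := by
  ext i j; simp

theorem conj_mulVec {n : ℕ} (B : Matrix (Fin n) (Fin n) ℂ) (v : Fin n → ℂ) :
    (fun i => starRingEnd ℂ ((B *ᵥ v) i)) =
      B.map (starRingEnd ℂ) *ᵥ fun i => starRingEnd ℂ (v i) := by
  ext i
  simp [Matrix.mulVec, dotProduct]

section
variable {n : ℕ} {σ δ : ℝ} {A T : Matrix (Fin n) (Fin n) ℂ}

/-- The relation `T A* = -σ A T` is iterated. Even powers carry no sign, which is why the even times
are compatible with both reductions. -/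
theorem mul_map_conj_pow (hσ : σ = 1 ∨ σ = -1)
    (hTA : A * T + (σ : ℂ) • (T * A.map (starRingEnd ℂ)) = 0) (k : ℕ) :
    T * (A ^ k).map (starRingEnd ℂ) = ((-σ : ℝ) : ℂ) ^ k • (A ^ k * T) := by
  have hσ2 : (σ : ℂ) * σ = 1 := by rcases hσ with rfl | rfl <;> simp
  have h1 : T * A.map (starRingEnd ℂ) = ((-σ : ℝ) : ℂ) • (A * T) := by
    rw [eq_neg_of_add_eq_zero_left hTA, smul_neg, ← neg_smul, smul_smul]
    simp [hσ2]
  induction k with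
  | zero => simp [Matrix.map_one]
  | succ k ih =>
    rw [pow_succ, map_conj_mul, ← Matrix.mul_assoc, ih, Matrix.smul_mul, Matrix.mul_assoc, h1,
      Matrix.mul_smul, smul_smul, ← pow_succ, ← Matrix.mul_assoc]

/-- In the `x` term the signs `σ` (from `σx`) and `-σ` (from passing `A` through `T`) multiply to
`-1`. In the time term the `-1` comes from conjugating `i`. -/
theorem mul_map_conj_phase (hσ : σ = 1 ∨ σ = -1)
    (hTA : A * T + (σ : ℂ) • (T * A.map (starRingEnd ℂ)) = 0) {t : Times}
    (ht : Admissible A t) (x : ℝ) :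
    T * (phase A (σ * x) t).map (starRingEnd ℂ) = -phase A x t * T := by
  have hs : HasSum (fun j : ℕ+ => (t j : ℂ) • A ^ (2 * (j : ℕ)))
      (∑' j : ℕ+, (t j : ℂ) • A ^ (2 * (j : ℕ))) := Summable.hasSum ht
  set S := ∑' j : ℕ+, (t j : ℂ) • A ^ (2 * (j : ℕ)) with hS
  have hσ2 : (σ : ℂ) * σ = 1 := by rcases hσ with rfl | rfl <;> simp
  have h1 := mul_map_conj_pow hσ hTA 1
  have h2 : T * S.map (starRingEnd ℂ) = S * T := by
    have a : HasSum (fun j : ℕ+ => T * ((t j : ℂ) • A ^ (2 * (j : ℕ))).map (starRingEnd ℂ))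
        (T * S.map (starRingEnd ℂ)) :=
      (hs.map (starRingEnd ℂ).toAddMonoidHom.mapMatrix continuous_map_conj).mul_left T
    have e : (fun j : ℕ+ => T * ((t j : ℂ) • A ^ (2 * (j : ℕ))).map (starRingEnd ℂ)) =
        fun j : ℕ+ => (t j : ℂ) • A ^ (2 * (j : ℕ)) * T := by
      ext1 j
      have e' : ((t j : ℂ) • A ^ (2 * (j : ℕ))).map (starRingEnd ℂ) =
          (t j : ℂ) • (A ^ (2 * (j : ℕ))).map (starRingEnd ℂ) := by
        ext; simp
      have e'' : ((-σ : ℝ) : ℂ) ^ (2 * (j : ℕ)) = 1 := by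
        rw [pow_mul]; rcases hσ with rfl | rfl <;> simp
      rw [e', Matrix.mul_smul, mul_map_conj_pow hσ hTA, e'', one_smul, Matrix.smul_mul]
    rw [e] at a
    exact a.unique (hs.mul_right T)
  have h3 : (phase A (σ * x) t).map (starRingEnd ℂ) =
      ((σ * x : ℂ) / 2) • A.map (starRingEnd ℂ) - (Complex.I / 2) • S.map (starRingEnd ℂ) := by
    rw [phase, ← hS]
    ext i j
    simp only [Matrix.map_apply, Matrix.add_apply, Matrix.sub_apply, Matrix.smul_apply,
      smul_eq_mul, map_add, map_mul, map_div₀, Complex.conj_ofReal, Complex.conj_I, map_ofNat,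
      Complex.ofReal_mul]
    ring
  rw [pow_one] at h1
  rw [h3, Matrix.mul_sub, Matrix.mul_smul, Matrix.mul_smul, h1, h2, phase, ← hS]
  rw [smul_smul]
  have h4 : (σ * x : ℂ) / 2 * ((-σ : ℝ) : ℂ) ^ 1 = -((x : ℂ) / 2) := by
    push_cast
    linear_combination (-(x : ℂ) / 2) * hσ2
  rw [h4, neg_smul, neg_add, Matrix.add_mul, Matrix.neg_mul, Matrix.neg_mul,
    Matrix.smul_mul, Matrix.smul_mul, sub_eq_add_neg]

theorem isUnit_of_mul_map_conj (hσ : σ = 1 ∨ σ = -1) (hδ : δ = 1 ∨ δ = -1)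
    (hTT : T * T.map (starRingEnd ℂ) = ((δ * σ : ℝ) : ℂ) • 1) : IsUnit T := by
  have h : T * (((δ * σ : ℝ) : ℂ) • T.map (starRingEnd ℂ)) = 1 := by
    rw [Matrix.mul_smul, hTT, smul_smul]
    rcases hσ with rfl | rfl <;> rcases hδ with rfl | rfl <;> simp
  exact (Matrix.isUnit_iff_isUnit_det T).mpr (Matrix.isUnit_det_of_right_inverse h)

theorem psi_eq_mulVec_conj_phi (hσ : σ = 1 ∨ σ = -1) (hT : IsUnit T) {Cp Cm : Fin n → ℂ}
    (hC : Cm = T *ᵥ (fun i => starRingEnd ℂ (Cp i)))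
    (hTA : A * T + (σ : ℂ) • (T * A.map (starRingEnd ℂ)) = 0) {t : Times}
    (ht : Admissible A t) (x : ℝ) :
    psi A Cm x t = T *ᵥ (fun i => starRingEnd ℂ (phi A Cp (σ * x) t i)) := by
  have hdet := (Matrix.isUnit_iff_isUnit_det T).mp hT
  have h1 : -phase A x t = T * (phase A (σ * x) t).map (starRingEnd ℂ) * T⁻¹ := by
    rw [mul_map_conj_phase hσ hTA ht, Matrix.mul_nonsing_inv_cancel_right _ _ hdet]
  rw [phi, conj_mulVec, map_conj_exp, psi, hC, h1, Matrix.exp_conj _ _ hT, Matrix.mulVec_mulVec,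
    Matrix.nonsing_inv_mul_cancel_right _ _ hdet, Matrix.mulVec_mulVec]

/-- The matrix of the reduction on the pair `(φ, ψ)`. -/
def swapMat (σ δ : ℝ) : Mat2 := !![0, ((δ * σ : ℝ) : ℂ); 1, 0]

theorem swapMat_mul (hσ : σ = 1 ∨ σ = -1) (hδ : δ = 1 ∨ δ = -1) :
    !![0, 1; ((δ * σ : ℝ) : ℂ), 0] * swapMat σ δ = 1 := by
  rcases hσ with rfl | rfl <;> rcases hδ with rfl | rfl <;>
  · ext i j
    fin_cases i <;> fin_cases j <;> simp [swapMat, Matrix.mul_apply, Fin.sum_univ_two]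

/-- The first column is `ψ = T φ*(σx)`. The second follows by applying this relation at `σx`, where
`σ² = 1` and `T T* = δσ` return a multiple of `φ(x)`. -/
theorem mul_map_conj_solutionMat (hσ : σ = 1 ∨ σ = -1) (hδ : δ = 1 ∨ δ = -1)
    {Cp Cm : Fin n → ℂ} (hC : Cm = T *ᵥ (fun i => starRingEnd ℂ (Cp i)))
    (hTA : A * T + (σ : ℂ) • (T * A.map (starRingEnd ℂ)) = 0)
    (hTT : T * T.map (starRingEnd ℂ) = ((δ * σ : ℝ) : ℂ) • 1) {t : Times}
    (ht : Admissible A t) (x : ℝ) :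
    T * (solutionMat A Cp Cm (σ * x) t).map (starRingEnd ℂ) =
      solutionMat A Cp Cm x t * swapMat σ δ := by
  have hT := isUnit_of_mul_map_conj hσ hδ hTT
  have h1 := psi_eq_mulVec_conj_phi hσ hT hC hTA ht x
  have h2 := psi_eq_mulVec_conj_phi hσ hT hC hTA ht (σ * x)
  have h3 : σ * (σ * x) = x := by rcases hσ with rfl | rfl <;> simp
  have h4 : T *ᵥ (fun i => starRingEnd ℂ (psi A Cm (σ * x) t i)) =
      ((δ * σ : ℝ) : ℂ) • phi A Cp x t := by
    rw [h2, h3, conj_mulVec, Matrix.mulVec_mulVec, hTT, Matrix.smul_mulVec, Matrix.one_mulVec]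
    simp
  ext i c
  fin_cases c
  · simpa [Matrix.mul_apply, Fin.sum_univ_two, solutionMat, swapMat, Matrix.mulVec, dotProduct]
      using (congrFun h1 i).symm
  · simpa [Matrix.mul_apply, Fin.sum_univ_two, solutionMat, swapMat, Matrix.mulVec, dotProduct,
      mul_comm] using congrFun h4 i

theorem mul_map_conj_term {m : ℕ} {Φ Ψ : Matrix (Fin n) (Fin m) ℂ} {P : Matrix (Fin m) (Fin m) ℂ}
    (hσ : σ = 1 ∨ σ = -1) (hTA : A * T + (σ : ℂ) • (T * A.map (starRingEnd ℂ)) = 0)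
    (h : T * Ψ.map (starRingEnd ℂ) = Φ * P) (k : ℕ) (p : Matrix (Fin m) (Fin m) ℂ) :
    T * (A ^ k * Ψ * p).map (starRingEnd ℂ) =
      A ^ k * Φ * (((-σ : ℝ) : ℂ) ^ k • (P * p.map (starRingEnd ℂ))) := by
  rw [map_conj_mul, map_conj_mul, ← Matrix.mul_assoc, ← Matrix.mul_assoc,
    mul_map_conj_pow hσ hTA, Matrix.smul_mul, Matrix.smul_mul, Matrix.mul_assoc (A ^ k) T, h,
    Matrix.mul_smul]
  simp only [Matrix.mul_assoc]

/-- If `p(λ)` annihilates `Ψ`, then the polynomial `P p*(-σλ)`, with conjugated coefficients,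
annihilates `Φ`. -/
theorem sum_mul_map_conj {m : ℕ} {Φ Ψ : Matrix (Fin n) (Fin m) ℂ} {P : Matrix (Fin m) (Fin m) ℂ}
    (hσ : σ = 1 ∨ σ = -1) (hTA : A * T + (σ : ℂ) • (T * A.map (starRingEnd ℂ)) = 0)
    (h : T * Ψ.map (starRingEnd ℂ) = Φ * P) {s : Finset ℕ} {p : ℕ → Matrix (Fin m) (Fin m) ℂ}
    (hp : ∑ k ∈ s, A ^ k * Ψ * p k = 0) :
    ∑ k ∈ s, A ^ k * Φ * (((-σ : ℝ) : ℂ) ^ k • (P * (p k).map (starRingEnd ℂ))) = 0 := by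
  simp only [← mul_map_conj_term hσ hTA h, ← Matrix.mul_sum]
  have : ∑ k ∈ s, (A ^ k * Ψ * p k).map (starRingEnd ℂ) =
      (∑ k ∈ s, A ^ k * Ψ * p k).map (starRingEnd ℂ) := by
    ext i j
    simp only [Matrix.sum_apply, Matrix.map_apply, map_sum]
  rw [this, hp]
  simp

end

/-! ### Conjugation symmetry of the Wronskian and of the annihilating polynomial -/

section
variable {M : ℕ} {σ δ : ℝ} {A T : Matrix (Fin (2 * (M + 1))) (Fin (2 * (M + 1))) ℂ}
  {Φ Ψ : Matrix (Fin (2 * (M + 1))) (Fin 2) ℂ}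

theorem det_wronskianMat_conj_ne_zero (hσ : σ = 1 ∨ σ = -1) (hδ : δ = 1 ∨ δ = -1)
    (hTA : A * T + (σ : ℂ) • (T * A.map (starRingEnd ℂ)) = 0)
    (h : T * Ψ.map (starRingEnd ℂ) = Φ * swapMat σ δ)
    (hdet : (wronskianMat A Φ (M + 1)).det ≠ 0) : (wronskianMat A Ψ (M + 1)).det ≠ 0 := by
  rw [det_wronskianMat_ne_zero_iff] at hdet ⊢
  intro p hp k hk
  have h0 := hdet _ (sum_mul_map_conj hσ hTA h hp) k hk
  have hσ0 : ((-σ : ℝ) : ℂ) ^ k ≠ 0 := by rcases hσ with rfl | rfl <;> simp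
  have h1 := congrArg (fun B => !![0, 1; ((δ * σ : ℝ) : ℂ), 0] * B)
    ((smul_eq_zero.mp h0).resolve_left hσ0)
  simp only [← Matrix.mul_assoc, swapMat_mul hσ hδ, Matrix.one_mul, Matrix.mul_zero] at h1
  rw [← map_conj_map_conj (p k), h1]
  simp

theorem coeff_one_dressing_conj (hσ : σ = 1 ∨ σ = -1) (hδ : δ = 1 ∨ δ = -1)
    (hTA : A * T + (σ : ℂ) • (T * A.map (starRingEnd ℂ)) = 0)
    (h : T * Ψ.map (starRingEnd ℂ) = Φ * swapMat σ δ)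
    (hdet : (wronskianMat A Φ (M + 1)).det ≠ 0) :
    PowerSeries.coeff 1 (dressing A Φ) 1 0 =
      -δ * starRingEnd ℂ (PowerSeries.coeff 1 (dressing A Ψ) 0 1) := by
  have hΨ := evalAt_dressing (det_wronskianMat_conj_ne_zero hσ hδ hTA h hdet)
  have hΦ := evalAt_dressing hdet
  rw [evalAt_eq_sum_range] at hΨ hΦ
  -- The factor `(-σ)ᴺ` normalizes the conjugated polynomial so that its leading coefficient is `S =
  -- swapMat σ δ`, as for `m S`. The difference of the two has degree less than `N` and annihilates
  -- `Φ`, so it is zero.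
  have hΨ' := congrArg (fun B : Matrix (Fin (2 * (M + 1))) (Fin 2) ℂ => B * (((-σ : ℝ) : ℂ) ^ (M + 1) • (1 : Mat2)))
    (sum_mul_map_conj hσ hTA h hΨ)
  have hΦ' := congrArg (fun B : Matrix (Fin (2 * (M + 1))) (Fin 2) ℂ => B * swapMat σ δ) hΦ
  simp only [Matrix.sum_mul, Matrix.zero_mul] at hΨ' hΦ'
  have hd := hΦ'.trans hΨ'.symm
  have hσM : ((-σ : ℝ) : ℂ) ^ (M + 1) * ((-σ : ℝ) : ℂ) ^ (M + 1) = 1 := by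
    rw [← mul_pow]; rcases hσ with rfl | rfl <;> simp
  rw [Finset.sum_range_succ _ (M + 1), Finset.sum_range_succ _ (M + 1), Nat.sub_self,
    coeff_zero_dressing,
    coeff_zero_dressing, Matrix.map_one _ (map_zero _) (map_one _)] at hd
  simp only [Matrix.mul_one, Matrix.mul_smul, smul_smul, hσM, one_smul, add_left_inj] at hd
  rw [← sub_eq_zero, ← Finset.sum_sub_distrib] at hd
  have hM := (det_wronskianMat_ne_zero_iff A Φ).mp hdet
    (fun k => PowerSeries.coeff (M + 1 - k) (dressing A Φ) * swapMat σ δ -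
      (((-σ : ℝ) : ℂ) ^ (M + 1) * ((-σ : ℝ) : ℂ) ^ k) •
        (swapMat σ δ * (PowerSeries.coeff (M + 1 - k) (dressing A Ψ)).map (starRingEnd ℂ)))
    (by
      rw [← hd]
      refine Finset.sum_congr rfl fun k _ => ?_
      rw [Matrix.mul_sub, Matrix.mul_smul]
      simp only [Matrix.mul_assoc]) M (Nat.lt_succ_self M)
  have hσM' : ((-σ : ℝ) : ℂ) ^ (M + 1) * ((-σ : ℝ) : ℂ) ^ M = -σ := by
    rw [pow_succ, mul_right_comm, ← mul_pow]
    rcases hσ with rfl | rfl <;> simp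
  rw [Nat.add_sub_cancel_left, hσM'] at hM
  -- At `λ^{N-1}` the comparison reads `m₁(Φ) S = -σ S m₁(Ψ)*`. Its lower right entry is `δσ
  -- (m₁(Φ))₁₀ = -σ (m₁(Ψ))₀₁*`.
  have h11 := congrFun₂ hM 1 1
  have s01 : swapMat σ δ 0 1 = δ * σ := by simp [swapMat]
  have s10 : swapMat σ δ 1 0 = 1 := rfl
  have s11 : swapMat σ δ 1 1 = 0 := rfl
  have hσ2 : (σ : ℂ) * σ = 1 := by rcases hσ with rfl | rfl <;> simp
  have hδ2 : (δ : ℂ) * δ = 1 := by rcases hδ with rfl | rfl <;> simp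
  rw [Matrix.sub_apply, Matrix.smul_apply, Matrix.mul_apply, Matrix.mul_apply, Fin.sum_univ_two,
    Fin.sum_univ_two, s01, s10, s11, Matrix.map_apply, Matrix.zero_apply, smul_eq_mul] at h11
  linear_combination (δ * σ : ℂ) * h11
    - (δ * δ * PowerSeries.coeff 1 (dressing A Φ) 1 0
      + δ * starRingEnd ℂ (PowerSeries.coeff 1 (dressing A Ψ) 0 1)) * hσ2
    - PowerSeries.coeff 1 (dressing A Φ) 1 0 * hδ2

end

end
end AKNS

/-! ### The reduced hierarchy -/

theorem mainTheorem4 (N : ℕ) (hN : 1 ≤ N) (σ δ : ℝ) (hσ : σ = 1 ∨ σ = -1) (hδ : δ = 1 ∨ δ = -1)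
    (A T : Matrix (Fin (2 * N)) (Fin (2 * N)) ℂ) (Cp Cm : Fin (2 * N) → ℂ)
    (hC : Cm = T *ᵥ (fun i => starRingEnd ℂ (Cp i)))
    (hTA : A * T + (σ : ℂ) • (T * A.map (starRingEnd ℂ)) = 0)
    (hTT : T * T.map (starRingEnd ℂ) = ((δ * σ : ℝ) : ℂ) • 1) :
    (∀ (x : ℝ) (t : AKNS.Times), AKNS.Admissible A t →
      AKNS.psi A Cm x t = T *ᵥ (fun i => starRingEnd ℂ (AKNS.phi A Cp (σ * x) t i))) ∧
    (∀ (x : ℝ) (t : AKNS.Times), AKNS.Admissible A t → AKNS.tauF A Cp Cm x t ≠ 0 →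
      AKNS.rSol A Cp Cm x t = AKNS.reduction σ δ (AKNS.qSol A Cp Cm) x t) ∧
    AKNS.SolvesNLSHierarchyOn σ δ (AKNS.qSol A Cp Cm)
      {p | AKNS.Admissible A p.2 ∧ AKNS.tauF A Cp Cm p.1 p.2 ≠ 0} := by
  obtain ⟨M, rfl⟩ : ∃ M, N = M + 1 := ⟨N - 1, by omega⟩
  have hsol := fun (x : ℝ) (t : AKNS.Times) (ht : AKNS.Admissible A t) =>
    AKNS.mul_map_conj_solutionMat hσ hδ hC hTA hTT ht x
  have hne : ∀ (x : ℝ) (t : AKNS.Times), AKNS.Admissible A t → AKNS.tauF A Cp Cm x t ≠ 0 →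
      AKNS.tauF A Cp Cm (σ * x) t ≠ 0 := by
    intro x t ht hf
    rw [AKNS.tauF_eq] at hf ⊢
    exact AKNS.det_wronskianMat_conj_ne_zero hσ hδ hTA (hsol x t ht) hf
  have hred : ∀ (x : ℝ) (t : AKNS.Times), AKNS.Admissible A t → AKNS.tauF A Cp Cm x t ≠ 0 →
      AKNS.rSol A Cp Cm x t = AKNS.reduction σ δ (AKNS.qSol A Cp Cm) x t := by
    intro x t ht hf
    rw [AKNS.reduction, AKNS.rSol_eq hf, AKNS.qSol_eq (hne x t ht hf),
      AKNS.coeff_one_dressing_conj hσ hδ hTA (hsol x t ht) (by rwa [← AKNS.tauF_eq])]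
    simp
  refine ⟨fun x t ht => AKNS.psi_eq_mulVec_conj_phi hσ
    (AKNS.isUnit_of_mul_map_conj hσ hδ hTT) hC hTA ht x, hred, ?_⟩
  rintro x t ⟨ht, hf⟩
  refine ⟨⟨ht, hne x t ht hf⟩, fun l => ⟨AKNS.contDiffAt_qSol ht l hf, ?_⟩⟩
  rw [AKNS.qSol_flow ht l hf]
  -- The flow involves `x`-derivatives of `r`, so the reduction identity is needed on a
  -- neighbourhood of `x`, not only at `x`.
  have ev : ∀ᶠ y in nhds x, AKNS.tauF A Cp Cm y t ≠ 0 := by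
    have := ((Continuous.prodMk_left (t l)).continuousAt (x := x)).eventually
      (AKNS.eventually_tauF_ne_zero ht l hf)
    simpa only [Function.update_eq_self] using this
  rw [AKNS.evalJet_congr Filter.EventuallyEq.rfl (ev.mono fun y hy => hred y t ht hy)]
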